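/- Let $d\ge 2$ and let the scalar field be $\mathbb{R}$ or $\mathbb{C}$. An $\varepsilon$-cube is an open cube $Q_\varepsilon$ of side length $\varepsilon$ with sides parallel to the coordinate axes, and $\mathcal F_\varepsilon$ always denotes a collection of mutually disjoint $\varepsilon$-cubes contained in $(0,1)^d$ with cardinality $|\mathcal F_\varepsilon|\le\varepsilon^{1-d}$. Let $f_Q$ be the average of $f$ over $Q$. For $f\in L^1((0,1)^d)$ put $$\|f\|_{\mathcal B}=\sup_{0<\varepsilon\le 1}\ \varepsilon^{d-1}\sup_{\mathcal F_\varepsilon}\sum_{Q_\varepsilon\in\mathcal F_\varepsilon}\frac1{|Q_\varepsilon|}\int_{Q_\varepsilon}|f(x)-f_{Q_\varepsilon}|\,dx ,$$ and let $\mathcal B$ be the Bourgain–Brezis–Mironescu space of all $f\in L^1((0,1)^d)$ with $\|f\|_{\mathcal B}<\infty$, taken modulo constants and normed by $\|\cdot\|_{\mathcal B}$. An atom is a measurable function $g$ on $(0,1)^d$ for which there are $\varepsilon\in(0,1]$ and a collection $\mathcal F_\varepsilon$ such that, almost everywhere, $g=0$ outside $\bigcup\mathcal F_\varepsilon$ and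 $|g|\le\varepsilon^{d-1}\frac1{|Q_\varepsilon|}$ on every $Q_\varepsilon\in\mathcal F_\varepsilon$, and $\int_{Q_\varepsilon}g\,dx=0$ for every $Q_\varepsilon\in\mathcal F_\varepsilon$. **Theorem.** There is an absolute constant $C>0$ (in particular independent of $d$) such that, for every $d\ge2$, $\mathcal B$ has an isometric predual $\mathcal B_*$: a Banach space $\mathcal B_*$ whose dual is isometrically isomorphic to $\mathcal B$. Every atom $g$ is (identified with) an element of $\mathcal B_*$, on which $f\in\mathcal B$ acts by $f(g)=\int_{(0,1)^d}fg\,dx$. Every $\varphi\in\mathcal B_*$ has a representation $$\varphi=\sum_{n=1}^\infty\lambda_n g_n\qquad\text{(convergence in }\mathcal B_*),$$ where $(\lambda_n)\in\ell^1$ and each $g_n$ is an atom. For every such representation the action of $f\in\mathcal B$ on $\varphi$ is $$f(\varphi)=\sum_{n=1}^\infty\lambda_n\int_{(0,1)^d}fg_n\,dx ,$$ and $$C\inf\sum_{n=1}^\infty|\lambda_n|\ \le\ \|\varphi\|_{\mathcal B_*}\ \le\ \inf\sum_{n=1}^\infty|\lambda_n| ,$$ where the infimum is taken over all such representations of $\varphi$.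 -/

import Mathlib

open MeasureTheory
open scoped ENNReal

/-- The open unit cube `(0,1)^d`. -/
def unitCube (d : ℕ) : Set (Fin d → ℝ) :=
  Set.univ.pi fun _ => Set.Ioo (0 : ℝ) 1

/-- The open axis-parallel cube with side length `ε` and centre `a`. -/
def cube {d : ℕ} (ε : ℝ) (a : Fin d → ℝ) : Set (Fin d → ℝ) :=
  Set.univ.pi fun i => Set.Ioo (a i - ε / 2) (a i + ε / 2)

/-- Lebesgue measure on the unit cube `(0,1)^d`. -/
noncomputable def cubeMeasure (d : ℕ) : Measure (Fin d → ℝ) :=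
  volume.restrict (unitCube d)

/-- `F` is the set of centres of a collection of mutually disjoint `ε`-cubes contained in
`(0,1)^d`, of cardinality at most `ε^(1-d)`. -/
structure IsCubeFamily {d : ℕ} (ε : ℝ) (F : Finset (Fin d → ℝ)) : Prop where
  subset : ∀ a ∈ F, cube ε a ⊆ unitCube d
  disjoint : ∀ a ∈ F, ∀ b ∈ F, a ≠ b → Disjoint (cube ε a) (cube ε b)
  card_le : (F.card : ℝ) ≤ ε ^ (1 - (d : ℤ))

section Norm

variable {𝕜 : Type*} [RCLike 𝕜] {d : ℕ}

/-- The mean oscillation `(1/|Q|) ∫_Q |f - f_Q|`, where `f_Q` is the average of `f` on `Q`. -/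
noncomputable def meanOsc (f : (Fin d → ℝ) → 𝕜) (Q : Set (Fin d → ℝ)) : ℝ≥0∞ :=
  (volume Q)⁻¹ * ∫⁻ x in Q, ‖f x - ⨍ y in Q, f y‖ₑ

/-- The quantity `[f]_ε`, with values in `[0, ∞]`. -/
noncomputable def bbmBracket (f : (Fin d → ℝ) → 𝕜) (ε : ℝ) : ℝ≥0∞ :=
  ENNReal.ofReal (ε ^ ((d : ℤ) - 1)) *
    ⨆ (F : Finset (Fin d → ℝ)) (_ : IsCubeFamily ε F), ∑ a ∈ F, meanOsc f (cube ε a)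

/-- The Bourgain–Brezis–Mironescu norm `sup_{0 < ε ≤ 1} [f]_ε`, with values in `[0, ∞]`. -/
noncomputable def bbmENorm (f : (Fin d → ℝ) → 𝕜) : ℝ≥0∞ :=
  ⨆ ε ∈ Set.Ioc (0 : ℝ) 1, bbmBracket f ε

lemma meanOsc_congr {f g : (Fin d → ℝ) → 𝕜} {Q : Set (Fin d → ℝ)} (hQ : Q ⊆ unitCube d)
    (h : f =ᵐ[cubeMeasure d] g) : meanOsc f Q = meanOsc g Q := by
  have h' : f =ᵐ[volume.restrict Q] g := ae_mono (Measure.restrict_mono hQ le_rfl) h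
  unfold meanOsc
  rw [average_congr h']
  congr 1
  refine lintegral_congr_ae ?_
  filter_upwards [h'] with x hx
  rw [hx]

lemma meanOsc_add_le {f g : (Fin d → ℝ) → 𝕜} {Q : Set (Fin d → ℝ)} (hQ : Q ⊆ unitCube d)
    (hf : Integrable f (cubeMeasure d)) (hg : Integrable g (cubeMeasure d)) :
    meanOsc (f + g) Q ≤ meanOsc f Q + meanOsc g Q := by
  have hf' : Integrable f (volume.restrict Q) := hf.mono_measure (Measure.restrict_mono hQ le_rfl)
  have hg' : Integrable g (volume.restrict Q) := hg.mono_measure (Measure.restrict_mono hQ le_rfl)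
  unfold meanOsc
  have hav : ⨍ y in Q, (f + g) y = (⨍ y in Q, f y) + ⨍ y in Q, g y := by
    simp only [average_eq, Pi.add_apply]
    rw [integral_add hf' hg', smul_add]
  rw [hav, ← mul_add]
  gcongr
  have hm : AEMeasurable (fun x => ‖f x - ⨍ y in Q, f y‖ₑ) (volume.restrict Q) :=
    (hf'.aestronglyMeasurable.sub aestronglyMeasurable_const).enorm
  rw [← lintegral_add_left' hm]
  refine lintegral_mono fun x => ?_
  have : (f + g) x - ((⨍ y in Q, f y) + ⨍ y in Q, g y)
      = (f x - ⨍ y in Q, f y) + (g x - ⨍ y in Q, g y) := by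
    simp only [Pi.add_apply]; ring
  rw [this]
  exact enorm_add_le _ _

lemma meanOsc_smul (c : 𝕜) (f : (Fin d → ℝ) → 𝕜) (Q : Set (Fin d → ℝ)) :
    meanOsc (c • f) Q = ‖c‖ₑ * meanOsc f Q := by
  unfold meanOsc
  have hav : ⨍ y in Q, (c • f) y = c * ⨍ y in Q, f y := by
    simp only [average_eq, Pi.smul_apply, smul_eq_mul]
    rw [integral_const_mul, mul_smul_comm]
  rw [hav, mul_left_comm, ← lintegral_const_mul' _ _ enorm_ne_top]
  congr 2
  ext x
  rw [← enorm_mul, mul_sub]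
  rfl

lemma bbmENorm_congr {f g : (Fin d → ℝ) → 𝕜} (h : f =ᵐ[cubeMeasure d] g) :
    bbmENorm f = bbmENorm g := by
  unfold bbmENorm bbmBracket
  refine iSup_congr fun ε => iSup_congr fun _ => ?_
  congr 1
  refine iSup_congr fun F => iSup_congr fun hF => Finset.sum_congr rfl fun a ha => ?_
  exact meanOsc_congr (hF.subset a ha) h

lemma bbmENorm_add_le {f g : (Fin d → ℝ) → 𝕜}
    (hf : Integrable f (cubeMeasure d)) (hg : Integrable g (cubeMeasure d)) :
    bbmENorm (f + g) ≤ bbmENorm f + bbmENorm g := by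
  refine iSup₂_le fun ε hε => ?_
  refine le_trans ?_ (add_le_add
    (le_iSup₂ (f := fun ε (_ : ε ∈ Set.Ioc (0 : ℝ) 1) => bbmBracket f ε) ε hε)
    (le_iSup₂ (f := fun ε (_ : ε ∈ Set.Ioc (0 : ℝ) 1) => bbmBracket g ε) ε hε))
  unfold bbmBracket
  rw [← mul_add]
  gcongr
  refine iSup₂_le fun F hF => ?_
  refine le_trans ?_ (add_le_add
    (le_iSup₂ (f := fun F (_ : IsCubeFamily ε F) => ∑ a ∈ F, meanOsc f (cube ε a)) F hF)
    (le_iSup₂ (f := fun F (_ : IsCubeFamily ε F) => ∑ a ∈ F, meanOsc g (cube ε a)) F hF))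
  rw [← Finset.sum_add_distrib]
  exact Finset.sum_le_sum fun a ha => meanOsc_add_le (hF.subset a ha) hf hg

lemma bbmENorm_smul (c : 𝕜) (f : (Fin d → ℝ) → 𝕜) :
    bbmENorm (c • f) = ‖c‖ₑ * bbmENorm f := by
  unfold bbmENorm bbmBracket
  simp only [meanOsc_smul, ← Finset.mul_sum, ENNReal.mul_iSup, mul_left_comm]

end Norm

/-- The functions `f ∈ L¹((0,1)^d)` whose Bourgain–Brezis–Mironescu norm is finite. -/
noncomputable def bbmSubmodule (𝕜 : Type*) [RCLike 𝕜] (d : ℕ) :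
    Submodule 𝕜 (Lp 𝕜 1 (cubeMeasure d)) where
  carrier := {f | bbmENorm f < ∞}
  zero_mem' := by
    have h : bbmENorm (𝕜 := 𝕜) (d := d) (0 : Lp 𝕜 1 (cubeMeasure d)) = 0 := by
      rw [bbmENorm_congr (Lp.coeFn_zero 𝕜 1 (cubeMeasure d)),
        ← zero_smul 𝕜 (0 : (Fin d → ℝ) → 𝕜), bbmENorm_smul]
      simp
    simp only [Set.mem_ofPred_eq, h, ENNReal.zero_lt_top]
  add_mem' := by
    intro f g hf hg
    simp only [Set.mem_ofPred_eq] at hf hg ⊢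
    rw [bbmENorm_congr (Lp.coeFn_add f g)]
    exact (bbmENorm_add_le (L1.integrable_coeFn f) (L1.integrable_coeFn g)).trans_lt
      (ENNReal.add_lt_top.2 ⟨hf, hg⟩)
  smul_mem' := by
    intro c f hf
    simp only [Set.mem_ofPred_eq] at hf ⊢
    rw [bbmENorm_congr (Lp.coeFn_smul c f), bbmENorm_smul]
    exact ENNReal.mul_lt_top enorm_lt_top hf

/-- The functions of the Bourgain–Brezis–Mironescu space, not yet taken modulo constants. This is
a copy of `bbmSubmodule 𝕜 d`, which carries the seminorm `sup_{0 < ε ≤ 1} [f]_ε` instead of the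
`L¹` norm. -/
def BBMFun (𝕜 : Type*) [RCLike 𝕜] (d : ℕ) : Type _ := bbmSubmodule 𝕜 d

namespace BBMFun

variable {𝕜 : Type*} [RCLike 𝕜] {d : ℕ}

noncomputable instance : AddCommGroup (BBMFun 𝕜 d) :=
  inferInstanceAs (AddCommGroup (bbmSubmodule 𝕜 d))

noncomputable instance : Module 𝕜 (BBMFun 𝕜 d) :=
  inferInstanceAs (Module 𝕜 (bbmSubmodule 𝕜 d))

/-- The underlying element of `L¹((0,1)^d)`. -/
def toL1 (f : BBMFun 𝕜 d) : Lp 𝕜 1 (cubeMeasure d) := f.1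

noncomputable instance : Norm (BBMFun 𝕜 d) := ⟨fun f => (bbmENorm f.toL1).toReal⟩

lemma bbmENorm_ne_top (f : BBMFun 𝕜 d) : bbmENorm f.toL1 ≠ ∞ := ne_of_lt f.2

lemma core : SeminormedSpace.Core 𝕜 (BBMFun 𝕜 d) where
  norm_nonneg f := ENNReal.toReal_nonneg
  norm_smul c f := by
    change (bbmENorm (c • f.toL1 : Lp 𝕜 1 (cubeMeasure d))).toReal = ‖c‖ * (bbmENorm f.toL1).toReal
    rw [bbmENorm_congr (Lp.coeFn_smul c f.toL1), bbmENorm_smul, ENNReal.toReal_mul, toReal_enorm]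
  norm_triangle f g := by
    change (bbmENorm (f.toL1 + g.toL1 : Lp 𝕜 1 (cubeMeasure d))).toReal
      ≤ (bbmENorm f.toL1).toReal + (bbmENorm g.toL1).toReal
    rw [bbmENorm_congr (Lp.coeFn_add f.toL1 g.toL1),
      ← ENNReal.toReal_add f.bbmENorm_ne_top g.bbmENorm_ne_top]
    exact ENNReal.toReal_mono (ENNReal.add_ne_top.2 ⟨f.bbmENorm_ne_top, g.bbmENorm_ne_top⟩)
      (bbmENorm_add_le (L1.integrable_coeFn _) (L1.integrable_coeFn _))

noncomputable instance : SeminormedAddCommGroup (BBMFun 𝕜 d) :=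
  SeminormedAddCommGroup.ofCore core

noncomputable instance : NormedSpace 𝕜 (BBMFun 𝕜 d) where
  norm_smul_le c f := (core.norm_smul c f).le

end BBMFun

/-- The Bourgain–Brezis–Mironescu space on `(0,1)^d`: functions with finite seminorm, modulo those
of seminorm zero. By `BBMFun.norm_eq_zero_iff` below these are exactly the constants. -/
abbrev BBM (𝕜 : Type*) [RCLike 𝕜] (d : ℕ) : Type _ := SeparationQuotient (BBMFun 𝕜 d)

/-- The class modulo constants of a function. -/
noncomputable abbrev BBM.mk {𝕜 : Type*} [RCLike 𝕜] {d : ℕ} (f : BBMFun 𝕜 d) : BBM 𝕜 d :=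
  SeparationQuotient.mk f

/-- `f` has seminorm zero if and only if it is almost everywhere constant. -/
lemma BBMFun.norm_eq_zero_iff {𝕜 : Type*} [RCLike 𝕜] {d : ℕ} (f : BBMFun 𝕜 d) :
    ‖f‖ = 0 ↔ ∃ c : 𝕜, f.toL1 =ᵐ[cubeMeasure d] fun _ => c := by
  have hc : cube 1 (fun _ => 1 / 2 : Fin d → ℝ) = unitCube d := by
    unfold cube unitCube; norm_num
  have hv : volume (unitCube d) = 1 := by
    unfold unitCube; rw [Real.volume_pi_Ioo]; simp
  constructor
  · intro h
    have h0 : bbmENorm f.toL1 = 0 :=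
      ((ENNReal.toReal_eq_zero_iff _).1 h).resolve_right f.bbmENorm_ne_top
    have h1 : bbmBracket f.toL1 1 = 0 := by
      simp only [bbmENorm, ENNReal.iSup_eq_zero] at h0
      exact h0 1 ⟨one_pos, le_rfl⟩
    have h2 : ∑ a ∈ {(fun _ => 1 / 2 : Fin d → ℝ)}, meanOsc f.toL1 (cube 1 a) = 0 := by
      have h3 := h1
      simp only [bbmBracket, one_zpow, ENNReal.ofReal_one, one_mul, ENNReal.iSup_eq_zero] at h3
      refine h3 _ ⟨?_, ?_, ?_⟩
      · intro a ha
        rw [Finset.mem_singleton.1 ha, hc]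
      · intro a ha b hb hab
        rw [Finset.mem_singleton.1 ha, Finset.mem_singleton.1 hb] at hab
        exact absurd rfl hab
      · simp
    rw [Finset.sum_singleton, hc, meanOsc, hv, inv_one, one_mul] at h2
    refine ⟨⨍ y in unitCube d, f.toL1 y, ?_⟩
    have hm : AEMeasurable (fun x => ‖f.toL1 x - ⨍ y in unitCube d, f.toL1 y‖ₑ)
        (volume.restrict (unitCube d)) :=
      ((Lp.aestronglyMeasurable f.toL1).sub aestronglyMeasurable_const).enorm
    rw [lintegral_eq_zero_iff' hm] at h2
    filter_upwards [h2] with x hx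
    simpa [sub_eq_zero] using hx
  · rintro ⟨c, h⟩
    change (bbmENorm f.toL1).toReal = 0
    rw [bbmENorm_congr h]
    have : bbmENorm (fun _ : Fin d → ℝ => c) = 0 := by
      simp only [bbmENorm, ENNReal.iSup_eq_zero]
      intro ε hε
      simp only [bbmBracket, mul_eq_zero, ENNReal.iSup_eq_zero]
      right
      intro F hF
      refine Finset.sum_eq_zero fun a ha => ?_
      have hpos : volume (cube ε a) ≠ 0 := by
        unfold cube
        rw [Real.volume_pi_Ioo]
        refine Finset.prod_ne_zero_iff.2 fun i _ => ?_
        rw [Ne, ENNReal.ofReal_eq_zero]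
        linarith [hε.1]
      have hfin : volume (cube ε a) ≠ ∞ :=
        ne_top_of_le_ne_top (by rw [hv]; exact ENNReal.one_ne_top)
          (measure_mono (hF.subset a ha))
      rw [meanOsc, setAverage_const hpos hfin]
      simp
    rw [this]
    rfl

/-- `g` is an atom associated with `0 < ε ≤ 1` and the collection of `ε`-cubes with centres in `F`:
it vanishes off the cubes, is bounded by `ε^(d-1)/|Q|` on each cube `Q`, and has mean zero on
each cube. As for elements of `L^∞((0,1)^d)`, pointwise conditions are meant almost everywhere. -/
structure IsAtomFor {𝕜 : Type*} [RCLike 𝕜] {d : ℕ} (ε : ℝ) (F : Finset (Fin d → ℝ))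
    (g : (Fin d → ℝ) → 𝕜) : Prop where
  pos : 0 < ε
  le_one : ε ≤ 1
  family : IsCubeFamily ε F
  aestronglyMeasurable : AEStronglyMeasurable g (cubeMeasure d)
  support : ∀ᵐ x ∂(cubeMeasure d), x ∉ ⋃ a ∈ F, cube ε a → g x = 0
  bound : ∀ a ∈ F, ∀ᵐ x ∂(cubeMeasure d), x ∈ cube ε a →
    ‖g x‖ ≤ ε ^ ((d : ℤ) - 1) * (1 / volume.real (cube ε a))
  integral_eq_zero : ∀ a ∈ F, ∫ x in cube ε a, g x = 0

/-- The atoms on `(0,1)^d`. -/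
def Atom (𝕜 : Type*) [RCLike 𝕜] (d : ℕ) : Type _ :=
  {g : (Fin d → ℝ) → 𝕜 // ∃ (ε : ℝ) (F : Finset (Fin d → ℝ)), IsAtomFor ε F g}

/-- The pairing `∫_{(0,1)^d} f g dx`. -/
noncomputable def atomPairing {𝕜 : Type*} [RCLike 𝕜] {d : ℕ} (f : BBMFun 𝕜 d) (g : Atom 𝕜 d) : 𝕜 :=
  ∫ x in unitCube d, f.toL1 x * g.1 x

/-- Given a map `ι` that realizes atoms as elements of a normed space `P`, the pair `(lam, g)` is an
atomic representation `φ = ∑ₙ lam n • g n` (convergence in the norm of `P`) with `lam ∈ ℓ¹`. -/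
structure IsAtomicRep {𝕜 : Type*} [RCLike 𝕜] {d : ℕ} {P : Type*} [NormedAddCommGroup P]
    [NormedSpace 𝕜 P] (ι : Atom 𝕜 d → P) (φ : P) (lam : ℕ → 𝕜) (g : ℕ → Atom 𝕜 d) : Prop where
  summable : Summable fun n => ‖lam n‖
  hasSum : HasSum (fun n => lam n • ι (g n)) φ

/-- The set of all values `∑ₙ |lam n|` over the atomic representations of `φ`. -/
noncomputable def atomicSums {𝕜 : Type*} [RCLike 𝕜] {d : ℕ} {P : Type*} [NormedAddCommGroup P]
    [NormedSpace 𝕜 P] (ι : Atom 𝕜 d → P) (φ : P) : Set ℝ :=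
  {s | ∃ (lam : ℕ → 𝕜) (g : ℕ → Atom 𝕜 d), IsAtomicRep ι φ lam g ∧ s = ∑' n, ‖lam n‖}

/-! The predual `BBMPredual` is the closure, in the dual of 𝓑, of the functionals `f ↦ ∫ (f -
f_{(0,1)^d}) g` with `g` bounded. Evaluation maps 𝓑 into the dual of this space; it has to be shown
isometric and onto.

Isometry. Let `h` equal `ε^(d-1)/|Q| · (s - s_Q)` on each cube `Q` of a family, with `s` the
conjugate sign of `f - f_Q`. Then `∫ f h` is exactly the weighted sum of the oscillations of `f`. As
`u - u_Q` has mean zero, `s_Q` contributes nothing to `∫ u h`, so `h` has norm at most one in the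
predual. But `|s - s_Q|` may reach 2, so only `h/2` is an atom (`exists_norming_atom`). Thus
evaluation is exactly isometric, whereas atoms norm 𝓑 up to a factor 2.

Surjectivity. A functional on the predual induces one on `L^∞`. If the latter is small on indicators
of small sets, it is integration against some `f ∈ L¹` (`exists_L1_representation`), and the
functions `h` show `f ∈ 𝓑`. The smallness comes from equi-integrability, modulo constants, of the
unit ball of 𝓑 (`exists_uniform_integrability`). There an open set `U` of small measure is covered
by the maximal dyadic cells in which it has density above `t`. Their parents have density at most
`t`, so replacing `f_Q` by the global mean costs little. The oscillations of generation `k` are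
summed by splitting the cells into admissible families of `2^(k(d-1))` cubes; only large `k` occur.

Atomic series. By Hahn–Banach, the closure of the elements with an atomic representation of `ℓ¹`
norm at most one contains the ball of radius 1/2 (`HasAtomicRep.mem_closure`). Iterated
approximation, as in the open mapping theorem, gives exact series with coefficient sum at most
`4‖φ‖`, whence `C = 1/4`. -/

/-! ### Cubes and their volumes. -/

section Basics

variable {d : ℕ}

lemma volume_unitCube (d : ℕ) : volume (unitCube d) = 1 := by
  unfold unitCube; rw [Real.volume_pi_Ioo]; simp

instance isProbabilityMeasure_cubeMeasure (d : ℕ) : IsProbabilityMeasure (cubeMeasure d) :=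
  ⟨by rw [cubeMeasure, Measure.restrict_apply_univ, volume_unitCube]⟩

lemma measurableSet_unitCube (d : ℕ) : MeasurableSet (unitCube d) :=
  MeasurableSet.univ_pi fun _ => measurableSet_Ioo

lemma measurableSet_cube (ε : ℝ) (a : Fin d → ℝ) : MeasurableSet (cube ε a) :=
  MeasurableSet.univ_pi fun _ => measurableSet_Ioo

lemma volume_cube (ε : ℝ) (a : Fin d → ℝ) : volume (cube ε a) = ENNReal.ofReal ε ^ d := by
  unfold cube
  rw [Real.volume_pi_Ioo]
  simp [add_sub_sub_cancel]

lemma volume_real_cube {ε : ℝ} (hε : 0 < ε) (a : Fin d → ℝ) :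
    volume.real (cube ε a) = ε ^ d := by
  rw [Measure.real, volume_cube, ENNReal.toReal_pow, ENNReal.toReal_ofReal hε.le]

lemma volume_cube_ne_zero {ε : ℝ} (hε : 0 < ε) (a : Fin d → ℝ) : volume (cube ε a) ≠ 0 := by
  rw [volume_cube]
  exact pow_ne_zero _ (by simpa using hε)

lemma volume_cube_ne_top (ε : ℝ) (a : Fin d → ℝ) : volume (cube ε a) ≠ ∞ := by
  rw [volume_cube]
  exact ENNReal.pow_ne_top ENNReal.ofReal_ne_top

lemma cube_one_half (d : ℕ) : cube 1 (fun _ => 1 / 2 : Fin d → ℝ) = unitCube d := by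
  unfold cube unitCube; norm_num

lemma cubeMeasure_restrict {Q : Set (Fin d → ℝ)} (hQ : Q ⊆ unitCube d) (hm : MeasurableSet Q) :
    (cubeMeasure d).restrict Q = volume.restrict Q := by
  rw [cubeMeasure, Measure.restrict_restrict hm, Set.inter_eq_left.2 hQ]

lemma isCubeFamily_unitCube (d : ℕ) :
    IsCubeFamily 1 ({fun _ => 1 / 2} : Finset (Fin d → ℝ)) := by
  refine ⟨?_, ?_, ?_⟩
  · intro a ha
    rw [Finset.mem_singleton.1 ha, cube_one_half]
  · intro a ha b hb hab
    rw [Finset.mem_singleton.1 ha, Finset.mem_singleton.1 hb] at hab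
    exact absurd rfl hab
  · simp

end Basics

/-! ### Oscillation, and duality between cube families and atoms. -/

section Oscillation

variable {𝕜 : Type*} [RCLike 𝕜] {d : ℕ}

lemma integrableOn_of_subset_unitCube {f : (Fin d → ℝ) → 𝕜} (hf : Integrable f (cubeMeasure d))
    {Q : Set (Fin d → ℝ)} (hQ : Q ⊆ unitCube d) : IntegrableOn f Q :=
  hf.mono_measure (Measure.restrict_mono hQ le_rfl)

/-- The mean oscillation as a real number. -/
noncomputable def realOsc (f : (Fin d → ℝ) → 𝕜) (Q : Set (Fin d → ℝ)) : ℝ :=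
  (volume.real Q)⁻¹ * ∫ x in Q, ‖f x - ⨍ y in Q, f y‖

lemma realOsc_nonneg (f : (Fin d → ℝ) → 𝕜) (Q : Set (Fin d → ℝ)) : 0 ≤ realOsc f Q := by
  unfold realOsc; positivity

lemma meanOsc_eq_ofReal {f : (Fin d → ℝ) → 𝕜} {Q : Set (Fin d → ℝ)} (hf : IntegrableOn f Q)
    (h0 : volume Q ≠ 0) (ht : volume Q ≠ ∞) : meanOsc f Q = ENNReal.ofReal (realOsc f Q) := by
  have hpos : 0 < volume.real Q := ENNReal.toReal_pos h0 ht
  have hi : Integrable (fun x => f x - ⨍ y in Q, f y) (volume.restrict Q) :=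
    hf.sub (integrableOn_const ht)
  rw [meanOsc, realOsc, ENNReal.ofReal_mul (by positivity), ENNReal.ofReal_inv_of_pos hpos,
    ofReal_integral_norm_eq_lintegral_enorm hi, Measure.real, ENNReal.ofReal_toReal ht]

lemma bracket_term_eq_ofReal {f : (Fin d → ℝ) → 𝕜} (hf : Integrable f (cubeMeasure d)) {ε : ℝ}
    (hε : 0 < ε) {F : Finset (Fin d → ℝ)} (hF : IsCubeFamily ε F) :
    ENNReal.ofReal (ε ^ ((d : ℤ) - 1)) * ∑ a ∈ F, meanOsc f (cube ε a) =
      ENNReal.ofReal (ε ^ ((d : ℤ) - 1) * ∑ a ∈ F, realOsc f (cube ε a)) := by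
  rw [ENNReal.ofReal_mul (by positivity),
    ENNReal.ofReal_sum_of_nonneg fun a _ => realOsc_nonneg f _]
  congr 1
  refine Finset.sum_congr rfl fun a ha => ?_
  exact meanOsc_eq_ofReal (integrableOn_of_subset_unitCube hf (hF.subset a ha))
    (volume_cube_ne_zero hε a) (volume_cube_ne_top ε a)

lemma le_bbmENorm (f : (Fin d → ℝ) → 𝕜) {ε : ℝ} (hε : 0 < ε) (hε1 : ε ≤ 1)
    {F : Finset (Fin d → ℝ)} (hF : IsCubeFamily ε F) :
    ENNReal.ofReal (ε ^ ((d : ℤ) - 1)) * ∑ a ∈ F, meanOsc f (cube ε a) ≤ bbmENorm f := by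
  refine le_trans ?_ (le_iSup₂ (f := fun ε (_ : ε ∈ Set.Ioc (0 : ℝ) 1) => bbmBracket f ε) ε
    ⟨hε, hε1⟩)
  unfold bbmBracket
  gcongr
  exact le_iSup₂ (f := fun F (_ : IsCubeFamily ε F) => ∑ a ∈ F, meanOsc f (cube ε a)) F hF

lemma sum_realOsc_le_norm (u : BBMFun 𝕜 d) {ε : ℝ} (hε : 0 < ε) (hε1 : ε ≤ 1)
    {F : Finset (Fin d → ℝ)} (hF : IsCubeFamily ε F) :
    ε ^ ((d : ℤ) - 1) * ∑ a ∈ F, realOsc u.toL1 (cube ε a) ≤ ‖u‖ := by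
  have h := le_bbmENorm u.toL1 hε hε1 hF
  rw [bracket_term_eq_ofReal (L1.integrable_coeFn _) hε hF] at h
  exact (ENNReal.ofReal_le_iff_le_toReal u.bbmENorm_ne_top).1 h

lemma bbmENorm_le_ofReal {f : (Fin d → ℝ) → 𝕜} (hf : Integrable f (cubeMeasure d)) {K : ℝ}
    (h : ∀ (ε : ℝ) (F : Finset (Fin d → ℝ)), 0 < ε → ε ≤ 1 → IsCubeFamily ε F →
      ε ^ ((d : ℤ) - 1) * ∑ a ∈ F, realOsc f (cube ε a) ≤ K) :
    bbmENorm f ≤ ENNReal.ofReal K := by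
  refine iSup₂_le fun ε hε => ?_
  unfold bbmBracket
  simp only [ENNReal.mul_iSup]
  refine iSup₂_le fun F hF => ?_
  rw [bracket_term_eq_ofReal hf hε.1 hF]
  exact ENNReal.ofReal_le_ofReal (h ε F hε.1 hε.2 hF)

/-- The case `ε = 1` with a single cube. It makes centring continuous into `L¹`, so that bounded
functions act on 𝓑. -/
lemma realOsc_unitCube_le_norm (u : BBMFun 𝕜 d) :
    ∫ x, ‖u.toL1 x - ⨍ y in unitCube d, u.toL1 y‖ ∂(cubeMeasure d) ≤ ‖u‖ := by
  have h := sum_realOsc_le_norm u one_pos le_rfl (isCubeFamily_unitCube d)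
  rw [Finset.sum_singleton, cube_one_half, one_zpow, one_mul, realOsc, Measure.real,
    volume_unitCube, ENNReal.toReal_one, inv_one, one_mul] at h
  exact h

lemma integral_sub_average_mul_const {Q : Set (Fin d → ℝ)} {f : (Fin d → ℝ) → 𝕜}
    (hf : IntegrableOn f Q) (h0 : volume Q ≠ 0) (ht : volume Q ≠ ∞) (c : 𝕜) :
    ∫ x in Q, (f x - ⨍ y in Q, f y) * c = 0 := by
  rw [integral_mul_const, integral_sub hf (integrableOn_const ht), setIntegral_const,
    setAverage_eq, smul_inv_smul₀ (show volume.real Q ≠ 0 from (ENNReal.toReal_pos h0 ht).ne'),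
    sub_self, zero_mul]

/-- An atom is bounded almost everywhere. -/
lemma IsAtomFor.ae_bound {ε : ℝ} {F : Finset (Fin d → ℝ)} {g : (Fin d → ℝ) → 𝕜}
    (hg : IsAtomFor ε F g) :
    ∀ᵐ x ∂(cubeMeasure d), ‖g x‖ ≤ ε ^ ((d : ℤ) - 1) * (1 / ε ^ d) := by
  have h := (Filter.eventually_all_finset F).2 hg.bound
  have hε := hg.pos
  filter_upwards [hg.support, h] with x hx hb
  by_cases hxU : x ∈ ⋃ a ∈ F, cube ε a
  · simp only [Set.mem_iUnion] at hxU
    obtain ⟨a, ha, hxa⟩ := hxU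
    simpa [volume_real_cube hg.pos] using hb a ha hxa
  · rw [hx hxU, norm_zero]
    positivity

lemma IsAtomFor.memLp_top {ε : ℝ} {F : Finset (Fin d → ℝ)} {g : (Fin d → ℝ) → 𝕜}
    (hg : IsAtomFor ε F g) : MemLp g ∞ (cubeMeasure d) :=
  memLp_top_of_bound hg.aestronglyMeasurable _ hg.ae_bound

lemma setIntegral_unitCube_of_ae_support {ε : ℝ} {F : Finset (Fin d → ℝ)}
    (hF : IsCubeFamily ε F) {w : (Fin d → ℝ) → 𝕜} (hw : Integrable w (cubeMeasure d))
    (h0 : ∀ᵐ x ∂(cubeMeasure d), x ∉ ⋃ a ∈ F, cube ε a → w x = 0) :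
    ∫ x in unitCube d, w x = ∑ a ∈ F, ∫ x in cube ε a, w x := by
  have hsub : (⋃ a ∈ F, cube ε a) ⊆ unitCube d := Set.iUnion₂_subset hF.subset
  have hm : MeasurableSet (⋃ a ∈ F, cube ε a) :=
    F.measurableSet_biUnion fun a _ => measurableSet_cube ε a
  rw [← integral_biUnion_finset F (fun a _ => measurableSet_cube ε a)
    (fun a ha b hb hab => hF.disjoint a ha b hb hab)
    (fun a ha => integrableOn_of_subset_unitCube hw (hF.subset a ha))]
  refine setIntegral_eq_of_subset_of_ae_sdiff_eq_zero
    (measurableSet_unitCube d).nullMeasurableSet hsub ?_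
  rw [cubeMeasure, ae_restrict_iff' (measurableSet_unitCube d)] at h0
  filter_upwards [h0] with x hx hx'
  exact hx hx'.1 hx'.2

lemma IsAtomFor.integrable_mul {ε : ℝ} {F : Finset (Fin d → ℝ)} {g : (Fin d → ℝ) → 𝕜}
    (hg : IsAtomFor ε F g) {u : (Fin d → ℝ) → 𝕜} (hu : Integrable u (cubeMeasure d)) :
    Integrable (fun x => u x * g x) (cubeMeasure d) :=
  hu.mul_bdd hg.aestronglyMeasurable hg.ae_bound

/-- An atom has mean zero on each of its cubes, so a constant may be subtracted from `u` on each
cube separately. -/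
lemma IsAtomFor.integral_mul_eq {ε : ℝ} {F : Finset (Fin d → ℝ)} {g : (Fin d → ℝ) → 𝕜}
    (hg : IsAtomFor ε F g) {u : (Fin d → ℝ) → 𝕜} (hu : Integrable u (cubeMeasure d)) :
    ∫ x in unitCube d, u x * g x =
      ∑ a ∈ F, ∫ x in cube ε a, (u x - ⨍ y in cube ε a, u y) * g x := by
  rw [setIntegral_unitCube_of_ae_support hg.family (hg.integrable_mul hu)]
  · refine Finset.sum_congr rfl fun a ha => ?_
    have hs := hg.family.subset a ha
    have hgi : IntegrableOn g (cube ε a) := integrableOn_of_subset_unitCube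
      (hg.memLp_top.integrable le_top) hs
    simp only [sub_mul]
    rw [integral_sub (integrableOn_of_subset_unitCube (hg.integrable_mul hu) hs)
      (hgi.const_mul _), integral_const_mul, hg.integral_eq_zero a ha, mul_zero, sub_zero]
  · filter_upwards [hg.support] with x hx hx'
    rw [hx hx', mul_zero]

lemma IsAtomFor.integral_eq_zero' {ε : ℝ} {F : Finset (Fin d → ℝ)} {g : (Fin d → ℝ) → 𝕜}
    (hg : IsAtomFor ε F g) : ∫ x in unitCube d, g x = 0 := by
  rw [setIntegral_unitCube_of_ae_support hg.family (hg.memLp_top.integrable le_top) hg.support]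
  exact Finset.sum_eq_zero hg.integral_eq_zero

/-- After centring `u` on each cube, the height `ε^(d-1)/|Q|` of an atom is precisely the weight of
the oscillation in the norm. -/
lemma norm_atomPairing_le (u : BBMFun 𝕜 d) (g : Atom 𝕜 d) : ‖atomPairing u g‖ ≤ ‖u‖ := by
  obtain ⟨g, ε, F, hg⟩ := g
  have hε := hg.pos
  have hui : Integrable u.toL1 (cubeMeasure d) := L1.integrable_coeFn _
  refine le_trans ?_ (sum_realOsc_le_norm u hg.pos hg.le_one hg.family)
  unfold atomPairing
  rw [hg.integral_mul_eq hui, Finset.mul_sum]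
  refine (norm_sum_le _ _).trans (Finset.sum_le_sum fun a ha => ?_)
  have hs := hg.family.subset a ha
  have hi : IntegrableOn (fun x => u.toL1 x - ⨍ y in cube ε a, u.toL1 y) (cube ε a) :=
    (integrableOn_of_subset_unitCube hui hs).sub (integrableOn_const (volume_cube_ne_top ε a))
  have hb : ∀ᵐ x ∂(volume.restrict (cube ε a)),
      ‖g x‖ ≤ ε ^ ((d : ℤ) - 1) * (volume.real (cube ε a))⁻¹ := by
    have h := hg.bound a ha
    rw [← cubeMeasure_restrict hs (measurableSet_cube ε a),
      ae_restrict_iff' (measurableSet_cube ε a)]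
    simpa only [one_div] using h
  refine (norm_integral_le_of_norm_le (hi.norm.const_mul
    (ε ^ ((d : ℤ) - 1) * (volume.real (cube ε a))⁻¹)) ?_).trans ?_
  · filter_upwards [hb] with x hx
    rw [norm_mul, mul_comm]
    gcongr
  · rw [integral_const_mul, realOsc, mul_assoc]

/-- The unimodular function `conj v / ‖v‖`, which is zero where `v` vanishes. -/
noncomputable def conjSign (v : 𝕜) : 𝕜 := (starRingEnd 𝕜) v * ((‖v‖⁻¹ : ℝ) : 𝕜)

lemma norm_conjSign_le (v : 𝕜) : ‖conjSign v‖ ≤ 1 := by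
  rw [conjSign, norm_mul, RCLike.norm_conj, RCLike.norm_ofReal, abs_inv, abs_norm]
  exact mul_inv_le_one

lemma mul_conjSign (v : 𝕜) : v * conjSign v = (‖v‖ : 𝕜) := by
  rw [conjSign, ← mul_assoc, RCLike.mul_conj]
  by_cases h : ‖v‖ = 0
  · simp [h]
  · have : (‖v‖ : 𝕜) ≠ 0 := by exact_mod_cast h
    push_cast
    field_simp

lemma measurable_conjSign : Measurable (conjSign : 𝕜 → 𝕜) :=
  (RCLike.continuous_conj.measurable).mul
    (RCLike.continuous_ofReal.measurable.comp measurable_norm.inv)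

/-- For every integrable `f` and every family of cubes there is an atom `g` such that `2 g` tests
the oscillation of `f` on the family. -/
lemma exists_norming_atom {f : (Fin d → ℝ) → 𝕜} (hf : Integrable f (cubeMeasure d)) {ε : ℝ}
    (hε : 0 < ε) (hε1 : ε ≤ 1) {F : Finset (Fin d → ℝ)} (hF : IsCubeFamily ε F) :
    ∃ g : Atom 𝕜 d, 2 * ∫ x in unitCube d, f x * g.1 x =
        ((ε ^ ((d : ℤ) - 1) * ∑ a ∈ F, realOsc f (cube ε a) : ℝ) : 𝕜) ∧
      ∀ u : BBMFun 𝕜 d, ‖2 * atomPairing u g‖ ≤ ‖u‖ := by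
  classical
  set s : (Fin d → ℝ) → (Fin d → ℝ) → 𝕜 :=
    fun a x => conjSign (f x - ⨍ y in cube ε a, f y) with hs
  set c : ℝ := ε ^ ((d : ℤ) - 1) * (ε ^ d)⁻¹ with hc
  have hc0 : 0 ≤ c := by positivity
  -- The half compensates for `|s - s_Q| ≤ 2`, so that `g` obeys the height bound `c` of an atom.
  set g : (Fin d → ℝ) → 𝕜 := fun x => ∑ a ∈ F, (cube ε a).indicator
    (fun x => ((c / 2 : ℝ) : 𝕜) * (s a x - ⨍ y in cube ε a, s a y)) x with hg
  have hsm : ∀ a, AEStronglyMeasurable (s a) (cubeMeasure d) := fun a =>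
    (measurable_conjSign.comp_aemeasurable
      (hf.aestronglyMeasurable.aemeasurable.sub_const _)).aestronglyMeasurable
  have hgQ : ∀ a ∈ F, ∀ x ∈ cube ε a,
      g x = ((c / 2 : ℝ) : 𝕜) * (s a x - ⨍ y in cube ε a, s a y) := by
    intro a ha x hx
    rw [hg]
    simp only
    rw [Finset.sum_eq_single a]
    · rw [Set.indicator_of_mem hx]
    · intro b hb hba
      exact Set.indicator_of_notMem
        (fun hxb => Set.disjoint_left.1 (hF.disjoint b hb a ha hba) hxb hx) _
    · exact fun h => absurd ha h
  have hsi : ∀ a ∈ F, IntegrableOn (s a) (cube ε a) := fun a ha =>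
    integrableOn_of_subset_unitCube
      (Integrable.of_bound (hsm a) 1 (Filter.Eventually.of_forall fun x => norm_conjSign_le _))
      (hF.subset a ha)
  have hsavg : ∀ a, ‖⨍ y in cube ε a, s a y‖ ≤ 1 := by
    intro a
    rw [setAverage_eq, norm_smul, norm_inv, Real.norm_of_nonneg measureReal_nonneg]
    have h := norm_setIntegral_le_of_norm_le_const (μ := volume)
      (volume_cube_ne_top ε a).lt_top (fun x _ => norm_conjSign_le (f x - ⨍ y in cube ε a, f y))
    rw [one_mul] at h
    exact (mul_le_mul_of_nonneg_left h (by positivity)).trans inv_mul_le_one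
  have hatom : IsAtomFor ε F g := by
    refine ⟨hε, hε1, hF, ?_, ?_, ?_, ?_⟩
    · refine Finset.aestronglyMeasurable_fun_sum F fun a _ => ?_
      exact (((hsm a).sub aestronglyMeasurable_const).const_mul _).indicator
        (measurableSet_cube ε a)
    · refine Filter.Eventually.of_forall fun x hx => Finset.sum_eq_zero fun a ha => ?_
      exact Set.indicator_of_notMem (fun h => hx (Set.mem_biUnion ha h)) _
    · intro a ha
      refine Filter.Eventually.of_forall fun x hx => ?_
      rw [hgQ a ha x hx, norm_mul, RCLike.norm_ofReal, abs_of_nonneg (by positivity),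
        volume_real_cube hε, one_div, ← hc]
      have h2 : ‖s a x - ⨍ y in cube ε a, s a y‖ ≤ 1 + 1 :=
        (norm_sub_le _ _).trans (add_le_add (norm_conjSign_le _) (hsavg a))
      nlinarith
    · intro a ha
      rw [setIntegral_congr_fun (measurableSet_cube ε a) (hgQ a ha)]
      simp only [mul_comm ((c / 2 : ℝ) : 𝕜)]
      exact integral_sub_average_mul_const (hsi a ha) (volume_cube_ne_zero hε a)
        (volume_cube_ne_top ε a) _
  have key : ∀ u : (Fin d → ℝ) → 𝕜, Integrable u (cubeMeasure d) →
      2 * ∫ x in unitCube d, u x * g x =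
        ∑ a ∈ F, (c : 𝕜) * ∫ x in cube ε a, (u x - ⨍ y in cube ε a, u y) * s a x := by
    intro u hu
    rw [hatom.integral_mul_eq hu, Finset.mul_sum]
    refine Finset.sum_congr rfl fun a ha => ?_
    have hus := integrableOn_of_subset_unitCube hu (hF.subset a ha)
    have hui : IntegrableOn (fun x => u x - ⨍ y in cube ε a, u y) (cube ε a) :=
      hus.sub (integrableOn_const (volume_cube_ne_top ε a))
    have h1 : ∫ x in cube ε a, (u x - ⨍ y in cube ε a, u y) * g x =
        ∫ x in cube ε a, (((c / 2 : ℝ) : 𝕜) * ((u x - ⨍ y in cube ε a, u y) * s a x) -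
          (u x - ⨍ y in cube ε a, u y) * (((c / 2 : ℝ) : 𝕜) * ⨍ y in cube ε a, s a y)) := by
      refine setIntegral_congr_fun (measurableSet_cube ε a) fun x hx => ?_
      simp only [hgQ a ha x hx]
      ring
    -- The average of `s a` drops out against the mean-zero factor. Hence `2 g` tests as well as the
    -- unimodular `s a`, with no loss of constant.
    rw [h1, integral_sub, integral_sub_average_mul_const hus (volume_cube_ne_zero hε a)
      (volume_cube_ne_top ε a), integral_const_mul, sub_zero, ← mul_assoc]
    · congr 1
      push_cast
      ring
    · exact (hui.mul_bdd (hsi a ha).aestronglyMeasurable (c := 1)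
        (Filter.Eventually.of_forall fun x => norm_conjSign_le _)).const_mul _
    · exact hui.mul_const _
  have hcosc : ∀ (u : (Fin d → ℝ) → 𝕜), ε ^ ((d : ℤ) - 1) * ∑ a ∈ F, realOsc u (cube ε a) =
      ∑ a ∈ F, c * ∫ x in cube ε a, ‖u x - ⨍ y in cube ε a, u y‖ := by
    intro u
    rw [Finset.mul_sum]
    refine Finset.sum_congr rfl fun a _ => ?_
    rw [realOsc, volume_real_cube hε, hc, mul_assoc]
  refine ⟨⟨g, ε, F, hatom⟩, ?_, fun u => ?_⟩
  · rw [hcosc]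
    refine (key f hf).trans ?_
    push_cast
    refine Finset.sum_congr rfl fun a _ => ?_
    congr 1
    refine Eq.trans ?_ integral_ofReal
    refine integral_congr_ae (Filter.Eventually.of_forall fun x => ?_)
    exact mul_conjSign _
  · refine le_trans ?_ (sum_realOsc_le_norm u hε hε1 hF)
    unfold atomPairing
    rw [key _ (L1.integrable_coeFn _), hcosc]
    refine (norm_sum_le _ _).trans (Finset.sum_le_sum fun a ha => ?_)
    rw [norm_mul, RCLike.norm_ofReal, abs_of_nonneg hc0]
    gcongr
    refine norm_integral_le_of_norm_le (((integrableOn_of_subset_unitCube (L1.integrable_coeFn _)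
      (hF.subset a ha)).sub (integrableOn_const (volume_cube_ne_top ε a))).norm) ?_
    refine Filter.Eventually.of_forall fun x => ?_
    rw [norm_mul]
    exact mul_le_of_le_one_right (norm_nonneg _) (norm_conjSign_le _)

end Oscillation

/-! ### Dyadic cells and the stopping-time decomposition. -/

section Dyadic

variable {d : ℕ}

/-- The index of the dyadic cell of side length `2^(-k)` that contains `x`. -/
noncomputable def dyadicIndex (k : ℕ) (x : Fin d → ℝ) : Fin d → ℤ := fun i => ⌊2 ^ k * x i⌋

/-- The half-open dyadic cell of side length `2^(-k)` with index `m`. -/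
def dyadicCell (k : ℕ) (m : Fin d → ℤ) : Set (Fin d → ℝ) := {x | dyadicIndex k x = m}

/-- The open cube that coincides almost everywhere with a dyadic cell. -/
noncomputable def dyadicCube (k : ℕ) (m : Fin d → ℤ) : Set (Fin d → ℝ) :=
  cube ((2 ^ k)⁻¹) (fun i => (m i + 1 / 2) / 2 ^ k)

/-- The indices of the dyadic cells of side length `2^(-k)` in the unit cube. -/
noncomputable def gridIndices (d k : ℕ) : Finset (Fin d → ℤ) :=
  Fintype.piFinset fun _ => Finset.Ico 0 (2 ^ k)

lemma mem_dyadicCell_self (k : ℕ) (x : Fin d → ℝ) : x ∈ dyadicCell k (dyadicIndex k x) := rfl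

lemma dyadicCell_eq_pi (k : ℕ) (m : Fin d → ℤ) : dyadicCell k m =
    Set.univ.pi fun i => Set.Ico ((m i : ℝ) / 2 ^ k) ((m i + 1) / 2 ^ k) := by
  ext x
  have h2 : (0 : ℝ) < 2 ^ k := by positivity
  simp only [dyadicCell, dyadicIndex, Set.mem_ofPred_eq, funext_iff, Set.mem_univ_pi, Set.mem_Ico,
    Int.floor_eq_iff, div_le_iff₀ h2, lt_div_iff₀ h2, mul_comm]

lemma dyadicCube_eq_pi (k : ℕ) (m : Fin d → ℤ) : dyadicCube k m =
    Set.univ.pi fun i => Set.Ioo ((m i : ℝ) / 2 ^ k) ((m i + 1) / 2 ^ k) := by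
  unfold dyadicCube cube
  congr 1
  ext i x
  have e1 : ((m i : ℝ) + 1 / 2) / 2 ^ k - (2 ^ k)⁻¹ / 2 = (m i : ℝ) / 2 ^ k := by
    field_simp; ring
  have e2 : ((m i : ℝ) + 1 / 2) / 2 ^ k + (2 ^ k)⁻¹ / 2 = ((m i : ℝ) + 1) / 2 ^ k := by
    field_simp; ring
  rw [e1, e2]

lemma measurableSet_dyadicCell (k : ℕ) (m : Fin d → ℤ) : MeasurableSet (dyadicCell k m) := by
  rw [dyadicCell_eq_pi]
  exact MeasurableSet.univ_pi fun _ => measurableSet_Ico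

lemma dyadicCell_ae_eq (k : ℕ) (m : Fin d → ℤ) : dyadicCell k m =ᵐ[volume] dyadicCube k m := by
  rw [dyadicCell_eq_pi, dyadicCube_eq_pi]
  exact Measure.univ_pi_Ico_ae_eq_Icc.trans Measure.univ_pi_Ioo_ae_eq_Icc.symm

lemma dyadicCube_subset_dyadicCell (k : ℕ) (m : Fin d → ℤ) : dyadicCube k m ⊆ dyadicCell k m := by
  rw [dyadicCell_eq_pi, dyadicCube_eq_pi]
  exact Set.pi_mono fun _ _ => Set.Ioo_subset_Ico_self

lemma dyadicCell_disjoint {k : ℕ} {m m' : Fin d → ℤ} (h : m ≠ m') :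
    Disjoint (dyadicCell k m) (dyadicCell k m') :=
  Set.disjoint_left.2 fun _ hx hx' => h (hx.symm.trans hx')

lemma volume_dyadicCube (k : ℕ) (m : Fin d → ℤ) :
    volume (dyadicCube k m) = (2⁻¹ : ℝ≥0∞) ^ (k * d) := by
  rw [dyadicCube, volume_cube, ENNReal.ofReal_inv_of_pos (by positivity),
    ENNReal.ofReal_pow zero_le_two, ENNReal.ofReal_ofNat, ENNReal.inv_pow, ← pow_mul]

lemma volume_dyadicCell (k : ℕ) (m : Fin d → ℤ) :
    volume (dyadicCell k m) = (2⁻¹ : ℝ≥0∞) ^ (k * d) := by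
  rw [measure_congr (dyadicCell_ae_eq k m), volume_dyadicCube]

lemma dyadicCube_subset_unitCube {k : ℕ} {m : Fin d → ℤ} (hm : m ∈ gridIndices d k) :
    dyadicCube k m ⊆ unitCube d := by
  rw [dyadicCube_eq_pi]
  refine Set.pi_mono fun i _ => Set.Ioo_subset_Ioo ?_ ?_
  · have := (Finset.mem_Ico.1 (Fintype.mem_piFinset.1 hm i)).1
    have : (0 : ℝ) ≤ m i := by exact_mod_cast this
    positivity
  · have := (Finset.mem_Ico.1 (Fintype.mem_piFinset.1 hm i)).2
    have h1 : m i + 1 ≤ 2 ^ k := this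
    have : (m i : ℝ) + 1 ≤ 2 ^ k := by exact_mod_cast h1
    rw [div_le_one (by positivity)]
    exact this

lemma dyadicIndex_mem_gridIndices {x : Fin d → ℝ} (hx : x ∈ unitCube d) (k : ℕ) :
    dyadicIndex k x ∈ gridIndices d k := by
  refine Fintype.mem_piFinset.2 fun i => Finset.mem_Ico.2 ?_
  have hi : x i ∈ Set.Ioo (0 : ℝ) 1 := hx i (Set.mem_univ i)
  have h2 : (0 : ℝ) < 2 ^ k := by positivity
  refine ⟨Int.floor_nonneg.2 (mul_nonneg h2.le hi.1.le), Int.floor_lt.2 ?_⟩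
  push_cast
  exact mul_lt_of_lt_one_right h2 hi.2

lemma dyadicIndex_eq_of_succ {k : ℕ} {x y : Fin d → ℝ}
    (h : dyadicIndex (k + 1) x = dyadicIndex (k + 1) y) : dyadicIndex k x = dyadicIndex k y := by
  funext i
  -- Integer division by 2 rounds down for negative numbers too, so the index of the parent is
  -- determined by the index of the cell.
  have key : ∀ z : ℝ, ⌊2 ^ k * z⌋ = ⌊2 ^ (k + 1) * z⌋ / 2 := fun z => by
    have h2 : 2 ^ k * z = 2 ^ (k + 1) * z / (2 : ℕ) := by push_cast; ring
    rw [h2, Int.floor_div_natCast, Nat.cast_ofNat]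
  have := congrFun h i
  simp only [dyadicIndex] at this ⊢
  rw [key, key, this]

lemma dyadicIndex_eq_of_le {k l : ℕ} (hl : l ≤ k) {x y : Fin d → ℝ}
    (h : dyadicIndex k x = dyadicIndex k y) : dyadicIndex l x = dyadicIndex l y := by
  induction k, hl using Nat.le_induction with
  | base => exact h
  | succ k _ ih => exact ih (dyadicIndex_eq_of_succ h)

lemma dyadicCell_subset_of_isOpen {U : Set (Fin d → ℝ)} (hU : IsOpen U) {x : Fin d → ℝ}
    (hx : x ∈ U) : ∃ k, dyadicCell k (dyadicIndex k x) ⊆ U := by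
  obtain ⟨r, hr, hball⟩ := Metric.isOpen_iff.1 hU x hx
  obtain ⟨k, hk⟩ := exists_pow_lt_of_lt_one hr (show (2⁻¹ : ℝ) < 1 by norm_num)
  refine ⟨k, fun y hy => hball ?_⟩
  rw [Metric.mem_ball, dist_pi_lt_iff hr]
  intro i
  have h1 := Int.abs_sub_lt_one_of_floor_eq_floor (congrFun hy i)
  rw [← mul_sub, abs_mul, abs_of_pos (by positivity : (0 : ℝ) < 2 ^ k)] at h1
  refine lt_trans ?_ hk
  rw [Real.dist_eq, inv_pow, ← one_div, lt_div_iff₀ (by positivity), mul_comm]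
  exact h1

/-- The indices of the maximal dyadic cells in which `U` has density more than `t`. -/
noncomputable def heavyIndices (U : Set (Fin d → ℝ)) (t : ℝ≥0∞) (k : ℕ) : Finset (Fin d → ℤ) :=
  open Classical in (gridIndices d k).filter fun m =>
    t * volume (dyadicCell k m) < volume (U ∩ dyadicCell k m) ∧
      ∀ x ∈ dyadicCell k m, ∀ l < k,
        volume (U ∩ dyadicCell l (dyadicIndex l x)) ≤ t * volume (dyadicCell l (dyadicIndex l x))

/-- The union of the maximal dyadic cells of generation `k`. -/
def heavySet (U : Set (Fin d → ℝ)) (t : ℝ≥0∞) (k : ℕ) : Set (Fin d → ℝ) :=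
  ⋃ m ∈ heavyIndices U t k, dyadicCell k m

variable {U : Set (Fin d → ℝ)} {t : ℝ≥0∞}

lemma mem_heavyIndices {k : ℕ} {m : Fin d → ℤ} : m ∈ heavyIndices U t k ↔ m ∈ gridIndices d k ∧
    t * volume (dyadicCell k m) < volume (U ∩ dyadicCell k m) ∧
      ∀ x ∈ dyadicCell k m, ∀ l < k, volume (U ∩ dyadicCell l (dyadicIndex l x)) ≤
        t * volume (dyadicCell l (dyadicIndex l x)) := by
  classical
  simp only [heavyIndices, Finset.mem_filter]

lemma measurableSet_heavySet (k : ℕ) : MeasurableSet (heavySet U t k) :=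
  Finset.measurableSet_biUnion _ fun m _ => measurableSet_dyadicCell k m

lemma mem_heavySet {k : ℕ} {x : Fin d → ℝ} :
    x ∈ heavySet U t k ↔ dyadicIndex k x ∈ heavyIndices U t k := by
  simp only [heavySet, dyadicCell, Set.mem_iUnion, Set.mem_ofPred_eq, exists_prop, exists_eq_right']

/-- The coarser of two nested heavy cells would violate the maximality of the finer one. -/
lemma pairwise_disjoint_heavySet : Pairwise (Function.onFun Disjoint (heavySet U t)) := by
  have key : ∀ k l, l < k → Disjoint (heavySet U t k) (heavySet U t l) := by
    intro k l hl
    refine Set.disjoint_left.2 fun x hk hl' => ?_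
    rw [mem_heavySet, mem_heavyIndices] at hk hl'
    exact (hk.2.2 x (mem_dyadicCell_self k x) l hl).not_gt hl'.2.1
  intro k l hkl
  rcases hkl.lt_or_gt with h | h
  · exact (key l k h).symm
  · exact key k l h

/-- Around a point of an open `U`, small cells lie inside `U` and have density `1 > t`; the first
generation with density above `t` is the maximal one. -/
lemma subset_iUnion_heavySet (hU : IsOpen U) (hU1 : U ⊆ unitCube d) (ht : t < 1) :
    U ⊆ ⋃ k, heavySet U t k := by
  classical
  intro x hx
  have hex : ∃ k, t * volume (dyadicCell k (dyadicIndex k x)) <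
      volume (U ∩ dyadicCell k (dyadicIndex k x)) := by
    obtain ⟨k, hk⟩ := dyadicCell_subset_of_isOpen hU hx
    refine ⟨k, ?_⟩
    rw [Set.inter_eq_right.2 hk, volume_dyadicCell]
    conv_rhs => rw [← one_mul ((2⁻¹ : ℝ≥0∞) ^ (k * d))]
    exact ENNReal.mul_lt_mul_left (pow_ne_zero _ (by simp)) (ENNReal.pow_ne_top (by simp)) ht
  refine Set.mem_iUnion.2 ⟨Nat.find hex, mem_heavySet.2 (mem_heavyIndices.2
    ⟨dyadicIndex_mem_gridIndices (hU1 hx) _, Nat.find_spec hex, ?_⟩)⟩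
  intro y hy l hl
  rw [dyadicIndex_eq_of_le hl.le hy]
  exact not_lt.1 (Nat.find_min hex hl)

lemma measure_heavySet (ν : Measure (Fin d → ℝ)) (k : ℕ) :
    ν (heavySet U t k) = ∑ m ∈ heavyIndices U t k, ν (dyadicCell k m) :=
  measure_biUnion_finset (fun _ _ _ _ h => dyadicCell_disjoint h)
    fun m _ => measurableSet_dyadicCell k m

lemma tsum_measure_heavySet_le (ν : Measure (Fin d → ℝ)) :
    ∑' k, ν (heavySet U t k) ≤ ν Set.univ := by
  rw [← measure_iUnion pairwise_disjoint_heavySet measurableSet_heavySet]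
  exact measure_mono (Set.subset_univ _)

lemma mul_tsum_volume_heavySet_le : t * ∑' k, volume (heavySet U t k) ≤ volume U := by
  calc t * ∑' k, volume (heavySet U t k) = ∑' k, t * volume (heavySet U t k) :=
        ENNReal.tsum_mul_left.symm
    _ ≤ ∑' k, volume.restrict U (heavySet U t k) := by
        refine ENNReal.tsum_le_tsum fun k => ?_
        rw [measure_heavySet, measure_heavySet, Finset.mul_sum]
        refine Finset.sum_le_sum fun m hm => ?_
        rw [Measure.restrict_apply (measurableSet_dyadicCell k m), Set.inter_comm]
        exact (mem_heavyIndices.1 hm).2.1.le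
    _ ≤ volume.restrict U Set.univ := tsum_measure_heavySet_le _
    _ = volume U := Measure.restrict_apply_univ U

/-- A cell of generation at most `K` is too large for a set of this measure to reach density above
`t` in it. -/
lemma heavyIndices_eq_empty {K k : ℕ} (hU : volume U ≤ t * (2⁻¹ : ℝ≥0∞) ^ (K * d)) (hk : k ≤ K) :
    heavyIndices U t k = ∅ := by
  refine Finset.eq_empty_of_forall_notMem fun m hm => ?_
  have h := (mem_heavyIndices.1 hm).2.1
  rw [volume_dyadicCell] at h
  refine (h.trans_le ((measure_mono Set.inter_subset_left).trans hU)).not_ge ?_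
  gcongr t * ?_
  exact pow_le_pow_right_of_le_one' (by simp) (Nat.mul_le_mul_right d hk)

/-- The parent has density at most `t` and is `2^d` times as large. Generation `k + 1` ensures that
there is a parent. -/
lemma volume_inter_heavy_le {k : ℕ} {m : Fin d → ℤ} (hm : m ∈ heavyIndices U t (k + 1)) :
    volume (U ∩ dyadicCell (k + 1) m) ≤ t * 2 ^ d * volume (dyadicCell (k + 1) m) := by
  rcases (dyadicCell (k + 1) m).eq_empty_or_nonempty with h | ⟨x, hx⟩
  · simp [h]
  have h := (mem_heavyIndices.1 hm).2.2 x hx k k.lt_succ_self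
  have hsub : dyadicCell (k + 1) m ⊆ dyadicCell k (dyadicIndex k x) := fun y hy =>
    dyadicIndex_eq_of_succ (hy.trans hx.symm)
  refine (measure_mono (Set.inter_subset_inter_right U hsub)).trans (h.trans_eq ?_)
  rw [volume_dyadicCell, volume_dyadicCell, mul_assoc, add_mul, one_mul, pow_add,
    mul_left_comm ((2 : ℝ≥0∞) ^ d), ← mul_pow, ENNReal.mul_inv_cancel two_ne_zero (by simp),
    one_pow, mul_one]

end Dyadic

/-- Remove blocks of exactly `n` elements until at most `n` remain; the extra `n` pays for the
incomplete last block. -/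
lemma Finset.sum_le_card_add_mul {α : Type*} {h : α → ℝ≥0∞} {B : ℝ≥0∞} {n : ℕ} (hn : 0 < n)
    (S : Finset α) (H : ∀ R ⊆ S, R.card ≤ n → ∑ a ∈ R, h a ≤ n * B) :
    ∑ a ∈ S, h a ≤ (S.card + n) * B := by
  classical
  induction S using Finset.strongInduction with
  | H S ih =>
    by_cases hS : S.card ≤ n
    · exact (H S subset_rfl hS).trans (by gcongr; exact le_add_self)
    · obtain ⟨R, hRS, hR⟩ := Finset.exists_subset_card_eq (not_le.1 hS).le
      have hne : R.Nonempty := Finset.card_pos.1 (hR ▸ hn)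
      have h1 := ih (S \ R) (Finset.sdiff_ssubset hRS hne)
        fun R' hR' => H R' (hR'.trans Finset.sdiff_subset)
      have h2 := H R hRS hR.le
      have hcard : (S.card : ℝ≥0∞) = (S \ R).card + n := by
        rw [← hR, ← Nat.cast_add, Finset.card_sdiff_add_card_eq_card hRS]
      rw [← Finset.sum_sdiff hRS, hcard, add_mul _ (n : ℝ≥0∞) B]
      exact add_le_add h1 h2

/-! ### Equi-integrability of the unit ball modulo constants. -/

section Equiintegrability

variable {𝕜 : Type*} [RCLike 𝕜] {d : ℕ}

/-- For `ε = 2^(-k)`, the number `2^(k(d-1))` is both the admissible cardinality `ε^(1-d)` and the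
inverse of the weight `ε^(d-1)`. The selected cubes are split into families of at most this size. -/
lemma sum_meanOsc_dyadicCube_le (hd : 1 ≤ d) (f : (Fin d → ℝ) → 𝕜) {k : ℕ}
    {S : Finset (Fin d → ℤ)} (hS : S ⊆ gridIndices d k) :
    ∑ m ∈ S, meanOsc f (dyadicCube k m) ≤ (S.card + 2 ^ (k * (d - 1))) * bbmENorm f := by
  classical
  have h := Finset.sum_le_card_add_mul (h := fun m => meanOsc f (dyadicCube k m))
    (B := bbmENorm f) (n := 2 ^ (k * (d - 1))) (by positivity) S ?_
  · exact_mod_cast h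
  intro R hR hcard
  have h2k : (0 : ℝ) < 2 ^ k := by positivity
  set centre : (Fin d → ℤ) → (Fin d → ℝ) := fun m i => (m i + 1 / 2) / 2 ^ k with hcentre
  have hinj : Function.Injective centre := by
    intro m m' h
    funext i
    have := congrFun h i
    simp only [hcentre] at this
    have h3 : (m i : ℝ) = m' i := by
      field_simp at this
      linarith
    exact_mod_cast h3
  have hzpow : ((2 ^ k : ℝ)⁻¹) ^ ((d : ℤ) - 1) = (2 ^ (k * (d - 1)))⁻¹ := by
    rw [show (d : ℤ) - 1 = ((d - 1 : ℕ) : ℤ) by omega, zpow_natCast, inv_pow, ← pow_mul]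
  have hfam : IsCubeFamily ((2 ^ k : ℝ)⁻¹) (R.image centre) := by
    refine ⟨?_, ?_, ?_⟩
    · intro a ha
      obtain ⟨m, hm, rfl⟩ := Finset.mem_image.1 ha
      exact dyadicCube_subset_unitCube (hS (hR hm))
    · intro a ha b hb hab
      obtain ⟨m, hm, rfl⟩ := Finset.mem_image.1 ha
      obtain ⟨m', hm', rfl⟩ := Finset.mem_image.1 hb
      exact (dyadicCell_disjoint fun h => hab (congrArg centre h)).mono
        (dyadicCube_subset_dyadicCell k m) (dyadicCube_subset_dyadicCell k m')
    · rw [← neg_sub, zpow_neg, hzpow, inv_inv]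
      exact_mod_cast Finset.card_image_le.trans hcard
  have hle := le_bbmENorm f (inv_pos.2 h2k)
    (inv_le_one_of_one_le₀ (one_le_pow₀ one_le_two)) hfam
  rw [Finset.sum_image hinj.injOn, hzpow, ENNReal.ofReal_inv_of_pos (by positivity),
    ENNReal.ofReal_pow zero_le_two, ENNReal.ofReal_ofNat, mul_comm, ← div_eq_mul_inv,
    ENNReal.div_le_iff (by simp) (by simp)] at hle
  rw [mul_comm, Nat.cast_pow, Nat.cast_ofNat]
  exact hle

lemma volume_mul_enorm_average_sub_le {Q : Set (Fin d → ℝ)} {f : (Fin d → ℝ) → 𝕜}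
    (hf : IntegrableOn f Q) (h0 : volume Q ≠ 0) (ht : volume Q ≠ ∞) (c : 𝕜) :
    volume Q * ‖(⨍ y in Q, f y) - c‖ₑ ≤ ∫⁻ x in Q, ‖f x - c‖ₑ := by
  refine le_trans (le_of_eq ?_) (enorm_integral_le_lintegral_enorm _)
  have hpos : volume.real Q ≠ 0 := (ENNReal.toReal_pos h0 ht).ne'
  have h1 : ∫ x in Q, (f x - c) = volume.real Q • ((⨍ y in Q, f y) - c) := by
    rw [integral_sub hf (integrableOn_const ht), setIntegral_const, smul_sub, setAverage_eq,
      smul_inv_smul₀ hpos]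
  rw [h1, enorm_smul, Real.enorm_of_nonneg measureReal_nonneg, Measure.real,
    ENNReal.ofReal_toReal ht]

/-- Write `f - c = (f - f_Q) + (f_Q - c)`. The first term is integrated over all of `Q`; the second
is constant, so only the small share of `U` in `Q` counts, and `|Q| |f_Q - c|` is at most `∫_Q |f -
c|`. -/
lemma lintegral_heavy_le {f : (Fin d → ℝ) → 𝕜} (hf : Integrable f (cubeMeasure d)) (c : 𝕜)
    {U : Set (Fin d → ℝ)} {t : ℝ≥0∞} {k : ℕ} {m : Fin d → ℤ}
    (hm : m ∈ heavyIndices U t (k + 1)) :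
    ∫⁻ x in U ∩ dyadicCell (k + 1) m, ‖f x - c‖ₑ ≤
      (2⁻¹ : ℝ≥0∞) ^ ((k + 1) * d) * meanOsc f (dyadicCube (k + 1) m) +
        t * 2 ^ d * ∫⁻ x in dyadicCube (k + 1) m, ‖f x - c‖ₑ := by
  set Q := dyadicCube (k + 1) m with hQ
  have hQ0 : volume Q ≠ 0 := volume_cube_ne_zero (by positivity) _
  have hQt : volume Q ≠ ∞ := volume_cube_ne_top _ _
  have hfQ : IntegrableOn f Q := integrableOn_of_subset_unitCube hf
    (dyadicCube_subset_unitCube (mem_heavyIndices.1 hm).1)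
  set a := ⨍ y in Q, f y with ha
  have h1 : (2⁻¹ : ℝ≥0∞) ^ ((k + 1) * d) * meanOsc f Q = ∫⁻ x in Q, ‖f x - a‖ₑ := by
    rw [← volume_dyadicCube (k + 1) m, ← hQ, meanOsc, ← mul_assoc,
      ENNReal.mul_inv_cancel hQ0 hQt, one_mul]
  have hcong : volume.restrict (dyadicCell (k + 1) m) = volume.restrict Q :=
    Measure.restrict_congr_set (dyadicCell_ae_eq _ _)
  calc ∫⁻ x in U ∩ dyadicCell (k + 1) m, ‖f x - c‖ₑ
      ≤ ∫⁻ x in U ∩ dyadicCell (k + 1) m, (‖f x - a‖ₑ + ‖a - c‖ₑ) := by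
        refine lintegral_mono fun x => ?_
        have : f x - c = (f x - a) + (a - c) := by ring
        rw [this]
        exact enorm_add_le _ _
    _ = (∫⁻ x in U ∩ dyadicCell (k + 1) m, ‖f x - a‖ₑ) +
          ‖a - c‖ₑ * volume (U ∩ dyadicCell (k + 1) m) := by
        rw [lintegral_add_right _ measurable_const, setLIntegral_const]
    _ ≤ (∫⁻ x in dyadicCell (k + 1) m, ‖f x - a‖ₑ) +
          ‖a - c‖ₑ * (t * 2 ^ d * volume (dyadicCell (k + 1) m)) :=
        add_le_add (lintegral_mono_set Set.inter_subset_right)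
          (mul_le_mul_right (volume_inter_heavy_le hm) _)
    _ = (2⁻¹ : ℝ≥0∞) ^ ((k + 1) * d) * meanOsc f Q + t * 2 ^ d * (volume Q * ‖a - c‖ₑ) := by
        rw [h1, hcong, measure_congr (dyadicCell_ae_eq _ _)]
        ring
    _ ≤ _ := by
        gcongr
        exact volume_mul_enorm_average_sub_le hfQ hQ0 hQt c

lemma sum_heavy_meanOsc_le (hd : 1 ≤ d) (f : (Fin d → ℝ) → 𝕜) (U : Set (Fin d → ℝ))
    (t : ℝ≥0∞) (k : ℕ) :
    ∑ m ∈ heavyIndices U t k, (2⁻¹ : ℝ≥0∞) ^ (k * d) * meanOsc f (dyadicCube k m) ≤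
      (volume (heavySet U t k) + 2⁻¹ ^ k) * bbmENorm f := by
  rw [← Finset.mul_sum, measure_heavySet]
  refine (mul_le_mul_right (sum_meanOsc_dyadicCube_le hd f
    fun m hm => (mem_heavyIndices.1 hm).1) _).trans (le_of_eq ?_)
  simp only [volume_dyadicCell, Finset.sum_const, nsmul_eq_mul]
  rw [← mul_assoc, mul_add, mul_comm _ ((heavyIndices U t k).card : ℝ≥0∞)]
  congr 2
  obtain ⟨e, rfl⟩ : ∃ e, d = e + 1 := ⟨d - 1, by omega⟩
  rw [Nat.add_sub_cancel, mul_add, mul_one, pow_add, mul_right_comm, ← mul_pow,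
    ENNReal.inv_mul_cancel two_ne_zero (by simp), one_pow, one_mul]

lemma ENNReal.tsum_geometric_ite_le (K : ℕ) :
    ∑' k, (if k ≤ K then (0 : ℝ≥0∞) else 2⁻¹ ^ k) ≤ 2⁻¹ ^ K := by
  rw [← ENNReal.summable.sum_add_tsum_nat_add' (k := K + 1),
    Finset.sum_eq_zero fun k hk => if_pos (Nat.lt_succ_iff.1 (Finset.mem_range.1 hk)), zero_add]
  have h : ∀ k, (if k + (K + 1) ≤ K then (0 : ℝ≥0∞) else 2⁻¹ ^ (k + (K + 1))) =
      2⁻¹ ^ (K + 1) * 2⁻¹ ^ k := fun k => by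
    rw [if_neg (by omega), pow_add, mul_comm]
  simp only [h]
  rw [ENNReal.tsum_mul_left, ENNReal.tsum_geometric, ENNReal.one_sub_inv_two, inv_inv, pow_succ,
    mul_assoc, ENNReal.inv_mul_cancel two_ne_zero (by simp), mul_one]

/-- The three terms on the right are the total volume of the heavy cells, the tail `∑_{k > K}
2^(-k)` from incomplete families, and the cost of passing from the local means to the global one. -/
lemma lintegral_open_le (hd : 1 ≤ d) {f : (Fin d → ℝ) → 𝕜} (hf : Integrable f (cubeMeasure d))
    {U : Set (Fin d → ℝ)} (hU : IsOpen U) (hU1 : U ⊆ unitCube d) {t : ℝ≥0∞} (ht0 : t ≠ 0)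
    (ht : t < 1) {K : ℕ} (hUK : volume U ≤ t * (2⁻¹ : ℝ≥0∞) ^ (K * d)) :
    ∫⁻ x in U, ‖f x - ⨍ y in unitCube d, f y‖ₑ ≤
      (2⁻¹ ^ K + 2⁻¹ ^ K + t * 2 ^ d) * bbmENorm f := by
  set c := ⨍ y in unitCube d, f y with hc
  set B := bbmENorm f with hB
  -- As a measure, `∫ |f - c|` can be summed over the disjoint heavy cells; its total mass is the
  -- oscillation on the unit cube.
  set ν : Measure (Fin d → ℝ) := (cubeMeasure d).withDensity fun x => ‖f x - c‖ₑ with hν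
  have hνuniv : ν Set.univ ≤ B := by
    have h := le_bbmENorm f one_pos le_rfl (isCubeFamily_unitCube d)
    rw [Finset.sum_singleton, cube_one_half, one_zpow, ENNReal.ofReal_one, one_mul, meanOsc,
      volume_unitCube, inv_one, one_mul] at h
    rwa [hν, withDensity_apply _ MeasurableSet.univ, Measure.restrict_univ]
  have hνcell : ∀ k, ∀ m ∈ heavyIndices U t k,
      ν (dyadicCell k m) = ∫⁻ x in dyadicCube k m, ‖f x - c‖ₑ := by
    intro k m hm
    have hs := dyadicCube_subset_unitCube (mem_heavyIndices.1 hm).1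
    have hae : dyadicCell k m =ᵐ[cubeMeasure d] dyadicCube k m :=
      ae_mono Measure.restrict_le_self (dyadicCell_ae_eq k m)
    rw [hν, withDensity_apply _ (measurableSet_dyadicCell k m), Measure.restrict_congr_set hae,
      cubeMeasure_restrict hs (measurableSet_cube _ _)]
  have hvol : ∑' k, volume (heavySet U t k) ≤ 2⁻¹ ^ K := by
    have h := (mul_tsum_volume_heavySet_le (U := U) (t := t)).trans hUK
    rw [ENNReal.mul_le_mul_iff_right ht0 ht.ne_top] at h
    exact h.trans (pow_le_pow_right_of_le_one' (by simp) (Nat.le_mul_of_pos_right K hd))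
  have hlevel : ∀ k, ∫⁻ x in U ∩ heavySet U t k, ‖f x - c‖ₑ ≤
      (volume (heavySet U t k) + if k ≤ K then 0 else 2⁻¹ ^ k) * B +
        t * 2 ^ d * ν (heavySet U t k) := by
    intro k
    by_cases hk : k ≤ K
    · have : heavySet U t k = ∅ := by
        rw [heavySet, heavyIndices_eq_empty hUK hk]; simp
      simp [this]
    rw [if_neg hk]
    -- Since `k > K`, generation zero is excluded and every heavy cell has a parent.
    obtain ⟨j, rfl⟩ : ∃ j, k = j + 1 := ⟨k - 1, by omega⟩
    calc ∫⁻ x in U ∩ heavySet U t (j + 1), ‖f x - c‖ₑ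
        = ∫⁻ x in heavySet U t (j + 1), ‖f x - c‖ₑ ∂(volume.restrict U) := by
          rw [Measure.restrict_restrict (measurableSet_heavySet _), Set.inter_comm]
      _ = ∑ m ∈ heavyIndices U t (j + 1), ∫⁻ x in U ∩ dyadicCell (j + 1) m, ‖f x - c‖ₑ := by
          rw [heavySet, lintegral_biUnion_finset (fun _ _ _ _ h => dyadicCell_disjoint h)
            fun m _ => measurableSet_dyadicCell _ m]
          refine Finset.sum_congr rfl fun m _ => ?_
          rw [Measure.restrict_restrict (measurableSet_dyadicCell _ m), Set.inter_comm]
      _ ≤ ∑ m ∈ heavyIndices U t (j + 1),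
            ((2⁻¹ : ℝ≥0∞) ^ ((j + 1) * d) * meanOsc f (dyadicCube (j + 1) m) +
              t * 2 ^ d * ν (dyadicCell (j + 1) m)) := by
          refine Finset.sum_le_sum fun m hm => ?_
          rw [hνcell _ m hm]
          exact lintegral_heavy_le hf c hm
      _ ≤ _ := by
          rw [Finset.sum_add_distrib, measure_heavySet ν, Finset.mul_sum]
          gcongr
          exact sum_heavy_meanOsc_le hd f U t (j + 1)
  calc ∫⁻ x in U, ‖f x - c‖ₑ = ∫⁻ x in ⋃ k, U ∩ heavySet U t k, ‖f x - c‖ₑ := by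
        rw [← Set.inter_iUnion, Set.inter_eq_left.2 (subset_iUnion_heavySet hU hU1 ht)]
    _ ≤ ∑' k, ∫⁻ x in U ∩ heavySet U t k, ‖f x - c‖ₑ := lintegral_iUnion_le _ _
    _ ≤ ∑' k, ((volume (heavySet U t k) + if k ≤ K then 0 else 2⁻¹ ^ k) * B +
          t * 2 ^ d * ν (heavySet U t k)) := ENNReal.tsum_le_tsum hlevel
    _ = (∑' k, volume (heavySet U t k) + ∑' k, if k ≤ K then 0 else 2⁻¹ ^ k) * B +
          t * 2 ^ d * ∑' k, ν (heavySet U t k) := by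
        rw [ENNReal.tsum_add, ENNReal.tsum_mul_right, ENNReal.tsum_add, ENNReal.tsum_mul_left]
    _ ≤ (2⁻¹ ^ K + 2⁻¹ ^ K) * B + t * 2 ^ d * B := by
        gcongr
        · exact ENNReal.tsum_geometric_ite_le K
        · exact (tsum_measure_heavySet_le ν).trans hνuniv
    _ = _ := by rw [← add_mul]

/-- The unit ball of the Bourgain–Brezis–Mironescu space is equi-integrable modulo constants. -/
theorem exists_uniform_integrability (𝕜 : Type*) [RCLike 𝕜] {d : ℕ} (hd : 1 ≤ d) {η : ℝ≥0∞}
    (hη : η ≠ 0) : ∃ δ : ℝ≥0∞, δ ≠ 0 ∧ ∀ f : (Fin d → ℝ) → 𝕜, Integrable f (cubeMeasure d) →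
      ∀ A, MeasurableSet A → cubeMeasure d A < δ →
        ∫⁻ x in A, ‖f x - ⨍ y in unitCube d, f y‖ₑ ∂(cubeMeasure d) ≤ η * bbmENorm f := by
  have hη2 : η / 2 ≠ 0 := by simpa using hη
  -- The choice of `t` makes `t 2^d` at most `η/2`, and `K` makes `2 · 2^(-K)` at most `η/2`.
  obtain ⟨t, ht0, ht⟩ : ∃ t : ℝ≥0∞, 0 < t ∧ t < min 1 (η / 2 / 2 ^ d) :=
    exists_between (lt_min one_pos (ENNReal.div_pos hη2 (by simp)))
  obtain ⟨K, hK⟩ : ∃ K : ℕ, (2⁻¹ : ℝ≥0∞) ^ K < η / 2 / 2 := by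
    have h := ENNReal.tendsto_pow_atTop_nhds_zero_of_lt_one (r := 2⁻¹) (by simp)
    exact (h.eventually_lt_const (ENNReal.div_pos hη2 (by simp))).exists
  refine ⟨t * 2⁻¹ ^ (K * d), mul_ne_zero ht0.ne' (pow_ne_zero _ (by simp)), ?_⟩
  intro f hf A hA hAδ
  rw [cubeMeasure, Measure.restrict_apply hA] at hAδ
  -- Outer regularity replaces `A` by an open set, as the covering by heavy cells requires.
  obtain ⟨V, hAV, hVo, hV⟩ := Set.exists_isOpen_lt_of_lt _ _ hAδ
  have hopen : IsOpen (unitCube d) := isOpen_set_pi Set.finite_univ fun _ _ => isOpen_Ioo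
  have h := lintegral_open_le hd hf (hVo.inter hopen) Set.inter_subset_right ht0.ne'
    (ht.trans_le (min_le_left _ _)) ((measure_mono Set.inter_subset_left).trans hV.le)
  rw [cubeMeasure, Measure.restrict_restrict hA]
  refine (lintegral_mono_set (Set.subset_inter hAV Set.inter_subset_right)).trans (h.trans ?_)
  gcongr
  have h1 : (2⁻¹ : ℝ≥0∞) ^ K + 2⁻¹ ^ K ≤ η / 2 :=
    (add_le_add hK.le hK.le).trans_eq (ENNReal.add_halves _)
  have h2 : t * 2 ^ d ≤ η / 2 :=
    (ENNReal.le_div_iff_mul_le (by simp) (by simp)).1 (ht.le.trans (min_le_right _ _))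
  exact (add_le_add h1 h2).trans_eq (ENNReal.add_halves _)

end Equiintegrability

lemma Lp.ae_norm_le_norm_top {α 𝕜 : Type*} [MeasurableSpace α] {μ : Measure α} [RCLike 𝕜]
    (g : Lp 𝕜 ∞ μ) : ∀ᵐ x ∂μ, ‖g x‖ ≤ ‖g‖ := by
  filter_upwards [ae_le_eLpNormEssSup (f := g) (μ := μ)] with x hx
  rw [Lp.norm_def, eLpNorm_exponent_top, ← toReal_enorm]
  refine ENNReal.toReal_mono ?_ hx
  rw [← eLpNorm_exponent_top]
  exact Lp.eLpNorm_ne_top g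

/-! ### Functionals on `L^∞` given by `L¹` functions. -/

section Representation

variable {α : Type*} [MeasurableSpace α] {μ : Measure α} [IsFiniteMeasure μ]
  {𝕜 : Type*} [RCLike 𝕜]

/-- The value of a functional on `L^∞` at the indicator function of a set. -/
noncomputable def indicatorValue (L : Lp 𝕜 ∞ μ →L[𝕜] 𝕜) (A : Set α) : 𝕜 :=
  open Classical in
    if hA : MeasurableSet A then L (indicatorConstLp ∞ hA (measure_ne_top μ A) 1) else 0

lemma indicatorValue_of_measurableSet (L : Lp 𝕜 ∞ μ →L[𝕜] 𝕜) {A : Set α} (hA : MeasurableSet A) :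
    indicatorValue L A = L (indicatorConstLp ∞ hA (measure_ne_top μ A) 1) := dif_pos hA

lemma indicatorValue_eq_zero_of_null (L : Lp 𝕜 ∞ μ →L[𝕜] 𝕜) {A : Set α} (hA : MeasurableSet A)
    (h : μ A = 0) : indicatorValue L A = 0 := by
  have h0 : indicatorConstLp ∞ hA (measure_ne_top μ A) (1 : 𝕜) = 0 := by
    refine Lp.ext (indicatorConstLp_coeFn.trans (Filter.EventuallyEq.trans ?_
      (Lp.coeFn_zero _ _ _).symm))
    filter_upwards [measure_eq_zero_iff_ae_notMem.1 h] with x hx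
    simp [hx]
  rw [indicatorValue_of_measurableSet L hA, h0, map_zero]

lemma indicatorValue_union (L : Lp 𝕜 ∞ μ →L[𝕜] 𝕜) {A B : Set α} (hA : MeasurableSet A)
    (hB : MeasurableSet B) (h : Disjoint A B) :
    indicatorValue L (A ∪ B) = indicatorValue L A + indicatorValue L B := by
  rw [indicatorValue_of_measurableSet L hA, indicatorValue_of_measurableSet L hB,
    indicatorValue_of_measurableSet L (hA.union hB),
    indicatorConstLp_disjoint_union hA hB (measure_ne_top μ A) (measure_ne_top μ B) h, map_add]

lemma indicatorValue_biUnion (L : Lp 𝕜 ∞ μ →L[𝕜] 𝕜) {f : ℕ → Set α}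
    (hf : ∀ i, MeasurableSet (f i)) (hd : Pairwise (Function.onFun Disjoint f)) (s : Finset ℕ) :
    indicatorValue L (⋃ i ∈ s, f i) = ∑ i ∈ s, indicatorValue L (f i) := by
  classical
  induction s using Finset.induction_on with
  | empty => simp [indicatorValue_eq_zero_of_null]
  | insert a s ha ih =>
    rw [Finset.set_biUnion_insert, Finset.sum_insert ha, ← ih]
    refine indicatorValue_union L (hf a) (s.measurableSet_biUnion fun i _ => hf i) ?_
    exact Set.disjoint_iUnion₂_right.2 fun i hi => hd fun h => ha (h ▸ hi)

/-- A functional on `L^∞` that is small on indicators of small sets, as a vector measure. -/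
noncomputable def indicatorVectorMeasure (L : Lp 𝕜 ∞ μ →L[𝕜] 𝕜)
    (h : ∀ η > (0 : ℝ), ∃ δ > (0 : ℝ), ∀ A, MeasurableSet A → μ.real A < δ →
      ‖indicatorValue L A‖ ≤ η) : VectorMeasure α 𝕜 where
  measureOf' := indicatorValue L
  empty' := indicatorValue_eq_zero_of_null L MeasurableSet.empty measure_empty
  not_measurable' A hA := dif_neg hA
  m_iUnion' f hf hd := by
    have hU : MeasurableSet (⋃ i, f i) := MeasurableSet.iUnion hf
    have hμ : HasSum (fun i => μ.real (f i)) (μ.real (⋃ i, f i)) := by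
      have := μ.toSignedMeasure.m_iUnion hf hd
      simpa only [Measure.toSignedMeasure_apply_measurable (hf _),
        Measure.toSignedMeasure_apply_measurable hU] using this
    refine Metric.tendsto_nhds.2 fun r hr => ?_
    obtain ⟨δ, hδ, H⟩ := h (r / 2) (half_pos hr)
    filter_upwards [Metric.tendsto_nhds.1 hμ δ hδ] with s hs
    have hsm : MeasurableSet (⋃ i ∈ s, f i) := s.measurableSet_biUnion fun i _ => hf i
    have hsub : (⋃ i ∈ s, f i) ⊆ ⋃ i, f i := Set.iUnion₂_subset fun i _ => Set.subset_iUnion f i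
    -- The error of a partial sum is the value on the uncovered remainder, whose measure tends to
    -- zero.
    have hdec := indicatorValue_union L hsm (hU.diff hsm) Set.disjoint_sdiff_right
    rw [Set.union_sdiff_cancel hsub, indicatorValue_biUnion L hf hd] at hdec
    have hreal : μ.real ((⋃ i, f i) \ ⋃ i ∈ s, f i) < δ := by
      rw [measureReal_sdiff hsub hsm, measureReal_biUnion_finset (fun i _ j _ hij => hd hij)
        fun i _ => hf i]
      rw [Real.dist_eq, abs_sub_comm] at hs
      exact (le_abs_self _).trans_lt hs
    rw [hdec, dist_eq_norm, sub_add_cancel_left, norm_neg]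
    exact (H _ (hU.diff hsm) hreal).trans_lt (half_lt_self hr)

/-- Radon–Nikodym for signed measures, applied to the real and imaginary parts. -/
lemma exists_integrable_density (v : VectorMeasure α 𝕜)
    (hv : ∀ A, MeasurableSet A → μ A = 0 → v A = 0) :
    ∃ f : α → 𝕜, Integrable f μ ∧ ∀ A, MeasurableSet A → ∫ x in A, f x ∂μ = v A := by
  have key : ∀ (p : 𝕜 →+ ℝ) (hp : Continuous p),
      ∃ r : α → ℝ, Integrable r μ ∧ ∀ A, MeasurableSet A → ∫ x in A, r x ∂μ = p (v A) := by
    intro p hp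
    have hac : v.mapRange p hp ≪ᵥ μ.toENNRealVectorMeasure := by
      refine VectorMeasure.AbsolutelyContinuous.mk fun A hA h0 => ?_
      rw [Measure.toENNRealVectorMeasure_apply_measurable hA] at h0
      rw [VectorMeasure.mapRange_apply, hv A hA h0, map_zero]
    have hi := SignedMeasure.integrable_rnDeriv (v.mapRange p hp) μ
    refine ⟨_, hi, fun A hA => ?_⟩
    rw [← withDensityᵥ_apply hi hA, SignedMeasure.withDensityᵥ_rnDeriv_eq _ μ hac,
      VectorMeasure.mapRange_apply]
  obtain ⟨r, hr, hrA⟩ := key RCLike.re RCLike.continuous_re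
  obtain ⟨s, hs, hsA⟩ := key RCLike.im RCLike.continuous_im
  refine ⟨fun x => (r x : 𝕜) + (s x : 𝕜) * RCLike.I, hr.ofReal.add (hs.ofReal.mul_const _),
    fun A hA => ?_⟩
  have hr' : Integrable (fun x => (r x : 𝕜)) (μ.restrict A) := hr.ofReal.integrableOn
  have hs' : Integrable (fun x => (s x : 𝕜) * RCLike.I) (μ.restrict A) :=
    (hs.ofReal.mul_const RCLike.I).integrableOn
  rw [integral_add hr' hs', integral_mul_const]
  have h1 : ∫ x in A, (r x : 𝕜) ∂μ = ((RCLike.re (v A) : ℝ) : 𝕜) := by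
    rw [← hrA A hA]; exact integral_ofReal
  have h2 : ∫ x in A, (s x : 𝕜) ∂μ = ((RCLike.im (v A) : ℝ) : 𝕜) := by
    rw [← hsA A hA]; exact integral_ofReal
  rw [h1, h2, RCLike.re_add_im]

/-- Simple functions are dense in `L^∞`. -/
lemma Lp.exists_simpleFunc_norm_sub_le_top (g : Lp 𝕜 ∞ μ) {η : ℝ} (hη : 0 < η) :
    ∃ s : SimpleFunc α 𝕜, ‖g - (s.memLp_top μ).toLp s‖ ≤ η := by
  classical
  set e := TopologicalSpace.denseSeq 𝕜
  have hcov : Metric.closedBall (0 : 𝕜) ‖g‖ ⊆ ⋃ n, Metric.ball (e n) η := fun y _ => by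
    obtain ⟨n, hn⟩ := (TopologicalSpace.denseRange_denseSeq 𝕜).exists_dist_lt y hη
    exact Set.mem_iUnion.2 ⟨n, hn⟩
  -- Essentially all values of `g` lie in a compact ball, so finitely many points of the dense
  -- sequence form an `η`-net; rounding to the nearest one gives the simple function.
  obtain ⟨T, hT⟩ := (isCompact_closedBall (0 : 𝕜) ‖g‖).elim_finite_subcover _
    (fun n => Metric.isOpen_ball) hcov
  set s : SimpleFunc α 𝕜 := (SimpleFunc.nearestPt e (T.sup id)).comp g
    (Lp.stronglyMeasurable g).measurable
  refine ⟨s, ?_⟩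
  have hb : ∀ᵐ x ∂μ, ‖(g - (s.memLp_top μ).toLp s : Lp 𝕜 ∞ μ) x‖ ≤ η := by
    filter_upwards [Lp.coeFn_sub g ((s.memLp_top μ).toLp s), (s.memLp_top μ).coeFn_toLp,
      Lp.ae_norm_le_norm_top g] with x hx hs hg
    rw [hx, Pi.sub_apply, hs]
    have hmem := hT (show g x ∈ Metric.closedBall (0 : 𝕜) ‖g‖ by simpa using hg)
    simp only [Set.mem_iUnion] at hmem
    obtain ⟨n, hn, hxn⟩ := hmem
    have h1 := SimpleFunc.edist_nearestPt_le e (g x) (show n ≤ T.sup id from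
      Finset.le_sup (f := id) hn)
    rw [edist_dist, edist_dist, ENNReal.ofReal_le_ofReal_iff dist_nonneg] at h1
    rw [← dist_eq_norm, dist_comm]
    refine h1.trans ?_
    rw [dist_comm]
    exact (Metric.mem_ball.1 hxn).le
  simpa using Lp.norm_le_of_ae_bound hη.le hb

/-- A continuous functional on `L^∞` that is small on indicators of small sets is integration
against an `L¹` function. -/
theorem exists_L1_representation (L : Lp 𝕜 ∞ μ →L[𝕜] 𝕜)
    (h : ∀ η > (0 : ℝ), ∃ δ > (0 : ℝ), ∀ A, MeasurableSet A → μ.real A < δ →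
      ‖indicatorValue L A‖ ≤ η) :
    ∃ f : Lp 𝕜 1 μ, ∀ g : Lp 𝕜 ∞ μ, L g = ∫ x, f x * g x ∂μ := by
  obtain ⟨f, hf, hfA⟩ := exists_integrable_density (indicatorVectorMeasure L h)
    fun A hA h0 => indicatorValue_eq_zero_of_null L hA h0
  have hfA' : ∀ A, MeasurableSet A → ∫ x in A, hf.toL1 f x ∂μ = indicatorValue L A := by
    intro A hA
    rw [← show ∫ x in A, f x ∂μ = indicatorValue L A from hfA A hA]
    exact integral_congr_ae (ae_restrict_of_ae hf.coeFn_toL1)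
  set I : Lp 𝕜 ∞ μ →L[𝕜] 𝕜 :=
    (ContinuousLinearMap.mul 𝕜 𝕜).lpPairing μ 1 ∞ (hf.toL1 f) with hI
  have hIapp : ∀ g : Lp 𝕜 ∞ μ, I g = ∫ x, hf.toL1 f x * g x ∂μ := fun g => by
    rw [hI, ContinuousLinearMap.lpPairing_eq_integral]; rfl
  refine ⟨hf.toL1 f, fun g => ?_⟩
  rw [← hIapp]
  have hsimple : ∀ s : SimpleFunc α 𝕜, L ((s.memLp_top μ).toLp s) = I ((s.memLp_top μ).toLp s) := by
    intro s
    induction s using SimpleFunc.induction with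
    | const c hs =>
      rename_i A
      have heq : ((SimpleFunc.piecewise A hs (SimpleFunc.const α c)
          (SimpleFunc.const α 0)).memLp_top μ).toLp _ =
          c • indicatorConstLp ∞ hs (measure_ne_top μ A) (1 : 𝕜) := by
        refine Lp.ext ?_
        filter_upwards [MemLp.coeFn_toLp ((SimpleFunc.piecewise A hs (SimpleFunc.const α c)
          (SimpleFunc.const α 0)).memLp_top μ),
          Lp.coeFn_smul c (indicatorConstLp ∞ hs (measure_ne_top μ A) (1 : 𝕜)),
          indicatorConstLp_coeFn (p := ∞) (hs := hs) (hμs := measure_ne_top μ A) (c := (1 : 𝕜))]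
          with x h1 h2 h3
        rw [h1, h2, Pi.smul_apply, h3]
        by_cases hx : x ∈ A <;> simp [hx]
      rw [heq, map_smul, map_smul, ← indicatorValue_of_measurableSet L hs, ← hfA' A hs, hIapp,
        ← integral_indicator hs]
      congr 1
      refine integral_congr_ae ?_
      filter_upwards [indicatorConstLp_coeFn (p := ∞) (hs := hs) (hμs := measure_ne_top μ A)
        (c := (1 : 𝕜))] with x hx
      rw [hx]
      by_cases hxA : x ∈ A <;> simp [hxA]
    | @add s t _ hs ht =>
      have heq : ((s + t).memLp_top μ).toLp (s + t : SimpleFunc α 𝕜) =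
          (s.memLp_top μ).toLp s + (t.memLp_top μ).toLp t := rfl
      rw [heq, map_add, map_add, hs, ht]
  have hle : ∀ η > (0 : ℝ), ‖(L - I) g‖ ≤ ‖L - I‖ * η := fun η hη => by
    obtain ⟨s, hs⟩ := Lp.exists_simpleFunc_norm_sub_le_top g hη
    have h0 : (L - I) ((s.memLp_top μ).toLp s) = 0 := by
      rw [sub_apply, hsimple, sub_self]
    rw [← sub_zero ((L - I) g), ← h0, ← map_sub]
    exact (L - I).le_opNorm_of_le hs
  have hzero : ‖(L - I) g‖ ≤ 0 := by
    refine le_of_forall_pos_le_add fun ε hε => ?_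
    have hpos : 0 < ‖L - I‖ + 1 := by positivity
    refine (hle (ε / (‖L - I‖ + 1)) (by positivity)).trans ?_
    rw [zero_add, mul_div_assoc', div_le_iff₀ hpos]
    nlinarith
  rw [← sub_eq_zero, ← sub_apply]
  exact norm_le_zero_iff.1 hzero

end Representation

/-! ### The predual and the identification of its dual. -/

section Predual

variable {𝕜 : Type*} [RCLike 𝕜] {d : ℕ}

lemma setAverage_unitCube (f : (Fin d → ℝ) → 𝕜) :
    ⨍ y in unitCube d, f y = ∫ y, f y ∂(cubeMeasure d) := by
  rw [setAverage_eq, Measure.real, volume_unitCube, ENNReal.toReal_one, inv_one, one_smul]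
  rfl

/-- Subtraction of the mean value on `L¹`. -/
noncomputable def centerL1 (𝕜 : Type*) [RCLike 𝕜] (d : ℕ) :
    Lp 𝕜 1 (cubeMeasure d) →L[𝕜] Lp 𝕜 1 (cubeMeasure d) :=
  ContinuousLinearMap.id 𝕜 _ - (Lp.constL 1 (cubeMeasure d) 𝕜).comp (L1.integralCLM' 𝕜)

lemma coeFn_centerL1 (f : Lp 𝕜 1 (cubeMeasure d)) :
    centerL1 𝕜 d f =ᵐ[cubeMeasure d] fun x => f x - ⨍ y in unitCube d, f y := by
  have h : centerL1 𝕜 d f = f - Lp.const 1 (cubeMeasure d) (⨍ y in unitCube d, f y) := by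
    rw [setAverage_unitCube, ← L1.integral_eq_integral, L1.integral_eq' 𝕜]
    rfl
  rw [h]
  filter_upwards [Lp.coeFn_sub f (Lp.const 1 (cubeMeasure d) (⨍ y in unitCube d, f y)),
    Lp.coeFn_const 1 (cubeMeasure d) (⨍ y in unitCube d, f y)] with x h1 h2
  rw [h1, Pi.sub_apply, h2]
  rfl

namespace BBMFun

/-- The inclusion of the space into `L¹`, as a linear map. -/
noncomputable def toL1ₗ (𝕜 : Type*) [RCLike 𝕜] (d : ℕ) :
    BBMFun 𝕜 d →ₗ[𝕜] Lp 𝕜 1 (cubeMeasure d) :=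
  (bbmSubmodule 𝕜 d).subtype

lemma norm_centerL1_le (f : BBMFun 𝕜 d) : ‖centerL1 𝕜 d f.toL1‖ ≤ ‖f‖ := by
  rw [L1.norm_eq_integral_norm]
  refine le_trans (le_of_eq ?_) (realOsc_unitCube_le_norm f)
  refine integral_congr_ae ?_
  filter_upwards [coeFn_centerL1 f.toL1] with x hx
  rw [hx]

/-- The map `f ↦ f - f_{(0,1)^d}` into `L¹`. -/
noncomputable def center (𝕜 : Type*) [RCLike 𝕜] (d : ℕ) :
    BBMFun 𝕜 d →L[𝕜] Lp 𝕜 1 (cubeMeasure d) :=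
  LinearMap.mkContinuous ((centerL1 𝕜 d).toLinearMap ∘ₗ toL1ₗ 𝕜 d) 1
    fun f => by rw [one_mul]; exact norm_centerL1_le f

end BBMFun

/-- The map `f ↦ f - f_{(0,1)^d}` into `L¹` on classes modulo constants. -/
noncomputable def BBM.center (𝕜 : Type*) [RCLike 𝕜] (d : ℕ) :
    BBM 𝕜 d →L[𝕜] Lp 𝕜 1 (cubeMeasure d) :=
  SeparationQuotient.liftCLM (BBMFun.center 𝕜 d)
    fun _ _ h => (h.map (BBMFun.center 𝕜 d).continuous).eq

/-- The functional `f ↦ ∫ (f - f_{(0,1)^d}) g` induced by `g ∈ L^∞`. -/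
noncomputable def BBM.toDual (𝕜 : Type*) [RCLike 𝕜] (d : ℕ) :
    Lp 𝕜 ∞ (cubeMeasure d) →L[𝕜] BBM 𝕜 d →L[𝕜] 𝕜 :=
  (((ContinuousLinearMap.mul 𝕜 𝕜).lpPairing (cubeMeasure d) 1 ∞).comp (BBM.center 𝕜 d)).flip

lemma BBM.toDual_apply_mk (g : Lp 𝕜 ∞ (cubeMeasure d)) (f : BBMFun 𝕜 d) :
    BBM.toDual 𝕜 d g (BBM.mk f) =
      ∫ x, (f.toL1 x - ⨍ y in unitCube d, f.toL1 y) * g x ∂(cubeMeasure d) := by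
  have h : BBM.toDual 𝕜 d g (BBM.mk f) = (ContinuousLinearMap.mul 𝕜 𝕜).lpPairing
      (cubeMeasure d) 1 ∞ (centerL1 𝕜 d f.toL1) g := rfl
  rw [h, ContinuousLinearMap.lpPairing_eq_integral]
  refine integral_congr_ae ?_
  filter_upwards [coeFn_centerL1 f.toL1] with x hx
  rw [hx, ContinuousLinearMap.mul_apply']

lemma BBM.integrable_mul_Lp_top {f : (Fin d → ℝ) → 𝕜} (hf : Integrable f (cubeMeasure d))
    (g : Lp 𝕜 ∞ (cubeMeasure d)) : Integrable (fun x => f x * g x) (cubeMeasure d) :=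
  hf.mul_bdd (Lp.aestronglyMeasurable g) (Lp.ae_norm_le_norm_top g)

/-- In this form, the pairing reduces to `∫ f g` as soon as either factor has mean zero: `g` for
atoms, `f` in the proof of surjectivity. -/
lemma BBM.toDual_apply_mk' (g : Lp 𝕜 ∞ (cubeMeasure d)) (f : BBMFun 𝕜 d) :
    BBM.toDual 𝕜 d g (BBM.mk f) = ∫ x, f.toL1 x * g x ∂(cubeMeasure d) -
      (∫ x, f.toL1 x ∂(cubeMeasure d)) * ∫ x, g x ∂(cubeMeasure d) := by
  rw [BBM.toDual_apply_mk, setAverage_unitCube]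
  simp only [sub_mul]
  rw [integral_sub (integrable_mul_Lp_top (L1.integrable_coeFn _) g)
    (((Lp.memLp g).integrable le_top).const_mul _), integral_const_mul]

namespace Atom

lemma memLp_top (g : Atom 𝕜 d) : MemLp g.1 ∞ (cubeMeasure d) := by
  obtain ⟨g, ε, F, hg⟩ := g
  exact hg.memLp_top

/-- An atom as an element of `L^∞`. -/
noncomputable def toLinfty (g : Atom 𝕜 d) : Lp 𝕜 ∞ (cubeMeasure d) := g.memLp_top.toLp g.1

lemma integral_mul_toLinfty (f : (Fin d → ℝ) → 𝕜) (g : Atom 𝕜 d) :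
    ∫ x, f x * g.toLinfty x ∂(cubeMeasure d) = ∫ x in unitCube d, f x * g.1 x := by
  refine integral_congr_ae ?_
  filter_upwards [g.memLp_top.coeFn_toLp] with x hx
  rw [toLinfty, hx]

lemma toDual_toLinfty (g : Atom 𝕜 d) (f : BBMFun 𝕜 d) :
    BBM.toDual 𝕜 d g.toLinfty (BBM.mk f) = atomPairing f g := by
  have h0 : ∫ x, g.toLinfty x ∂(cubeMeasure d) = 0 := by
    have h := integral_mul_toLinfty (fun _ => (1 : 𝕜)) g
    simp only [one_mul] at h
    obtain ⟨g, ε, F, hg⟩ := g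
    rw [h, hg.integral_eq_zero']
  rw [BBM.toDual_apply_mk', h0, mul_zero, sub_zero, integral_mul_toLinfty]
  rfl

end Atom

/-- The closure in the dual space of the set of functionals induced by bounded functions. -/
noncomputable def bbmPredualSubmodule (𝕜 : Type*) [RCLike 𝕜] (d : ℕ) :
    Submodule 𝕜 (StrongDual 𝕜 (BBM 𝕜 d)) :=
  (LinearMap.range (BBM.toDual 𝕜 d).toLinearMap).topologicalClosure

/-- The predual of the Bourgain–Brezis–Mironescu space. -/
def BBMPredual (𝕜 : Type*) [RCLike 𝕜] (d : ℕ) : Type _ := bbmPredualSubmodule 𝕜 d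

namespace BBMPredual

noncomputable instance : NormedAddCommGroup (BBMPredual 𝕜 d) :=
  inferInstanceAs (NormedAddCommGroup (bbmPredualSubmodule 𝕜 d))

noncomputable instance : NormedSpace 𝕜 (BBMPredual 𝕜 d) :=
  inferInstanceAs (NormedSpace 𝕜 (bbmPredualSubmodule 𝕜 d))

instance : CompleteSpace (BBMPredual 𝕜 d) :=
  (Submodule.isClosed_topologicalClosure _ :
    IsClosed (bbmPredualSubmodule 𝕜 d : Set (StrongDual 𝕜 (BBM 𝕜 d)))).completeSpace_coe

/-- The inclusion of the predual into the dual. -/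
noncomputable def incl (𝕜 : Type*) [RCLike 𝕜] (d : ℕ) :
    BBMPredual 𝕜 d →ₗᵢ[𝕜] StrongDual 𝕜 (BBM 𝕜 d) :=
  ⟨(bbmPredualSubmodule 𝕜 d).subtype, fun _ => rfl⟩

/-- A bounded function as an element of the predual. -/
noncomputable def ofLinfty (𝕜 : Type*) [RCLike 𝕜] (d : ℕ) :
    Lp 𝕜 ∞ (cubeMeasure d) →L[𝕜] BBMPredual 𝕜 d :=
  LinearMap.mkContinuous ((BBM.toDual 𝕜 d).toLinearMap.codRestrict (bbmPredualSubmodule 𝕜 d)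
    fun g => Submodule.le_topologicalClosure _ ⟨g, rfl⟩) ‖BBM.toDual 𝕜 d‖
    fun g => (BBM.toDual 𝕜 d).le_opNorm g

lemma denseRange_ofLinfty : DenseRange (ofLinfty 𝕜 d) := by
  refine Metric.denseRange_iff.2 fun φ r hr => ?_
  obtain ⟨_, ⟨g, rfl⟩, hg⟩ := Metric.mem_closure_iff.1 (show incl 𝕜 d φ ∈ closure
    (LinearMap.range (BBM.toDual 𝕜 d).toLinearMap : Set (StrongDual 𝕜 (BBM 𝕜 d))) from φ.2) r hr
  refine ⟨g, ?_⟩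
  rw [← (incl 𝕜 d).dist_map]
  exact hg

lemma norm_le_of_forall_mk {φ : BBMPredual 𝕜 d}
    (h : ∀ f : BBMFun 𝕜 d, ‖incl 𝕜 d φ (BBM.mk f)‖ ≤ ‖f‖) : ‖φ‖ ≤ 1 := by
  rw [← (incl 𝕜 d).norm_map]
  refine (incl 𝕜 d φ).opNorm_le_bound zero_le_one fun b => ?_
  obtain ⟨f, rfl⟩ := SeparationQuotient.surjective_mk b
  rw [one_mul, SeparationQuotient.norm_mk]
  exact h f

/-- An atom as an element of the predual. -/
noncomputable def ofAtom (g : Atom 𝕜 d) : BBMPredual 𝕜 d := ofLinfty 𝕜 d g.toLinfty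

lemma incl_ofAtom_mk (g : Atom 𝕜 d) (f : BBMFun 𝕜 d) :
    incl 𝕜 d (ofAtom g) (BBM.mk f) = atomPairing f g := g.toDual_toLinfty f

lemma norm_ofAtom_le (g : Atom 𝕜 d) : ‖ofAtom g‖ ≤ 1 :=
  norm_le_of_forall_mk fun f => by
    rw [incl_ofAtom_mk]
    exact norm_atomPairing_le f g

/-- Evaluation of the elements of the predual. -/
noncomputable def eval (𝕜 : Type*) [RCLike 𝕜] (d : ℕ) :
    BBM 𝕜 d →L[𝕜] StrongDual 𝕜 (BBMPredual 𝕜 d) :=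
  (incl 𝕜 d).toContinuousLinearMap.flip

lemma eval_apply (b : BBM 𝕜 d) (φ : BBMPredual 𝕜 d) :
    eval 𝕜 d b φ = incl 𝕜 d φ b := rfl

/-- A functional on the predual that acts on atoms by integration against `f ∈ L¹` controls the
norm of `f`. -/
lemma bbmENorm_le_of_forall_atom (Λ : StrongDual 𝕜 (BBMPredual 𝕜 d))
    (f : Lp 𝕜 1 (cubeMeasure d))
    (h : ∀ g : Atom 𝕜 d, Λ (ofAtom g) = ∫ x in unitCube d, f x * g.1 x) :
    bbmENorm f ≤ ENNReal.ofReal ‖Λ‖ := by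
  refine bbmENorm_le_ofReal (L1.integrable_coeFn f) fun ε F hε hε1 hF => ?_
  obtain ⟨g, hg, hgn⟩ := exists_norming_atom (L1.integrable_coeFn f) hε hε1 hF
  -- `norm_ofAtom_le` alone would give 2 here; the sharper bound is what makes evaluation isometric.
  have h1 : ‖(2 : 𝕜) • ofAtom g‖ ≤ 1 := norm_le_of_forall_mk fun u => by
    rw [map_smul, smul_apply, incl_ofAtom_mk, smul_eq_mul]
    exact hgn u
  have h2 : Λ ((2 : 𝕜) • ofAtom g) =
      ((ε ^ ((d : ℤ) - 1) * ∑ a ∈ F, realOsc f (cube ε a) : ℝ) : 𝕜) := by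
    rw [map_smul, h, smul_eq_mul, hg]
  have h3 := Λ.le_opNorm_of_le h1
  rw [h2, RCLike.norm_ofReal, mul_one] at h3
  exact (le_abs_self _).trans h3

/-- The lower bound applies `bbmENorm_le_of_forall_atom` to evaluation at `f` itself. -/
lemma norm_eval (b : BBM 𝕜 d) : ‖eval 𝕜 d b‖ = ‖b‖ := by
  refine le_antisymm ?_ ?_
  · refine (eval 𝕜 d b).opNorm_le_bound (norm_nonneg b) fun φ => ?_
    rw [eval_apply, mul_comm, ← (incl 𝕜 d).norm_map φ]
    exact (incl 𝕜 d φ).le_opNorm b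
  · obtain ⟨f, rfl⟩ := SeparationQuotient.surjective_mk b
    rw [SeparationQuotient.norm_mk]
    exact ENNReal.toReal_le_of_le_ofReal (norm_nonneg _)
      (bbmENorm_le_of_forall_atom _ f.toL1 fun g => incl_ofAtom_mk g f)

/-- Constants act as zero, which forces the `L¹` density of a functional on the predual to have mean
zero. -/
lemma toDual_one : BBM.toDual 𝕜 d (Lp.const ∞ (cubeMeasure d) 1) = 0 := by
  ext b
  obtain ⟨f, rfl⟩ := SeparationQuotient.surjective_mk b
  have h := Lp.coeFn_const ∞ (cubeMeasure d) (1 : 𝕜)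
  refine (BBM.toDual_apply_mk' _ f).trans ?_
  have h1 : ∫ x, f.toL1 x * Lp.const ∞ (cubeMeasure d) (1 : 𝕜) x ∂(cubeMeasure d) =
      ∫ x, f.toL1 x ∂(cubeMeasure d) := integral_congr_ae (by
    filter_upwards [h] with x hx
    rw [hx, Function.const_apply, mul_one])
  have h2 : ∫ x, Lp.const ∞ (cubeMeasure d) (1 : 𝕜) x ∂(cubeMeasure d) = 1 := by
    rw [integral_congr_ae h]
    simp
  rw [h1, h2, mul_one, sub_self]
  rfl

/-- Equi-integrability says that indicators of small sets have small norm in the predual; this gives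
countable additivity. -/
lemma indicatorValue_small (hd : 1 ≤ d) (Λ : StrongDual 𝕜 (BBMPredual 𝕜 d)) :
    ∀ η > (0 : ℝ), ∃ δ > (0 : ℝ), ∀ A, MeasurableSet A → (cubeMeasure d).real A < δ →
      ‖indicatorValue (Λ.comp (ofLinfty 𝕜 d)) A‖ ≤ η := by
  intro η hη
  have hpos : 0 < ‖Λ‖ + 1 := by positivity
  have hη' : 0 < η / (‖Λ‖ + 1) := by positivity
  obtain ⟨δ, hδ, H⟩ := exists_uniform_integrability 𝕜 hd
    (η := ENNReal.ofReal (η / (‖Λ‖ + 1))) (by simpa using hη')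
  -- The minimum with 1 keeps the threshold finite, so that it can be read as a real number.
  have hδ1 : min δ 1 ≠ ∞ := ne_top_of_le_ne_top ENNReal.one_ne_top (min_le_right _ _)
  refine ⟨(min δ 1).toReal, ENNReal.toReal_pos (by simpa using hδ) hδ1, fun A hA hAδ => ?_⟩
  have hAδ' : cubeMeasure d A < δ :=
    ((ENNReal.toReal_lt_toReal (measure_ne_top _ A) hδ1).1 hAδ).trans_le (min_le_left _ _)
  rw [indicatorValue_of_measurableSet _ hA]
  set χ : Lp 𝕜 ∞ (cubeMeasure d) := indicatorConstLp ∞ hA (measure_ne_top _ A) 1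
  have hχ : ‖BBM.toDual 𝕜 d χ‖ ≤ η / (‖Λ‖ + 1) := by
    refine (BBM.toDual 𝕜 d χ).opNorm_le_bound hη'.le fun b => ?_
    obtain ⟨f, rfl⟩ := SeparationQuotient.surjective_mk b
    have hval : BBM.toDual 𝕜 d χ (BBM.mk f) =
        ∫ x in A, (f.toL1 x - ⨍ y in unitCube d, f.toL1 y) ∂(cubeMeasure d) := by
      rw [BBM.toDual_apply_mk, ← integral_indicator hA]
      refine integral_congr_ae ?_
      filter_upwards [indicatorConstLp_coeFn (p := ∞) (hs := hA)
        (hμs := measure_ne_top (cubeMeasure d) A) (c := (1 : 𝕜))] with x hx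
      rw [hx]
      by_cases hxA : x ∈ A <;> simp [hxA]
    have h1 := (enorm_integral_le_lintegral_enorm _).trans
      (H f.toL1 (L1.integrable_coeFn _) A hA hAδ')
    rw [← hval] at h1
    have h2 := ENNReal.toReal_mono
      (ENNReal.mul_ne_top ENNReal.ofReal_ne_top f.bbmENorm_ne_top) h1
    rw [toReal_enorm, ENNReal.toReal_mul, ENNReal.toReal_ofReal hη'.le] at h2
    exact h2
  have h3 : ‖ofLinfty 𝕜 d χ‖ ≤ η / (‖Λ‖ + 1) := hχ
  refine (Λ.le_opNorm_of_le h3).trans ?_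
  rw [mul_div_assoc', div_le_iff₀ hpos]
  nlinarith

/-- The induced functional on `L^∞` has an `L¹` density; testing on atoms puts it in 𝓑, and density
of the bounded functions in the predual gives equality. -/
lemma eval_surjective (hd : 1 ≤ d) : Function.Surjective (eval 𝕜 d) := by
  intro Λ
  obtain ⟨f, hf⟩ := exists_L1_representation (Λ.comp (ofLinfty 𝕜 d)) (indicatorValue_small hd Λ)
  have hfB : bbmENorm f < ∞ :=
    (bbmENorm_le_of_forall_atom Λ f fun g => by
      rw [← g.integral_mul_toLinfty, ← hf]; rfl).trans_lt ENNReal.ofReal_lt_top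
  have h1 : ∫ x, f x ∂(cubeMeasure d) = 0 := by
    have h := hf (Lp.const ∞ (cubeMeasure d) 1)
    have h0 : ofLinfty 𝕜 d (Lp.const ∞ (cubeMeasure d) 1) = 0 :=
      (incl 𝕜 d).injective (toDual_one.trans (map_zero _).symm)
    rw [ContinuousLinearMap.comp_apply, h0, map_zero] at h
    rw [h]
    refine integral_congr_ae ?_
    filter_upwards [Lp.coeFn_const ∞ (cubeMeasure d) (1 : 𝕜)] with x hx
    rw [hx, Function.const_apply, mul_one]
  set u : BBMFun 𝕜 d := ⟨f, hfB⟩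
  have hu : ∀ g, eval 𝕜 d (BBM.mk u) (ofLinfty 𝕜 d g) = Λ (ofLinfty 𝕜 d g) := by
    intro g
    refine Eq.trans ?_ (hf g).symm
    refine (BBM.toDual_apply_mk' g u).trans ?_
    have : ∫ x, u.toL1 x ∂(cubeMeasure d) = 0 := h1
    rw [this, zero_mul, sub_zero]
    rfl
  refine ⟨BBM.mk u, DFunLike.coe_injective (denseRange_ofLinfty.equalizer
    (eval 𝕜 d (BBM.mk u)).continuous Λ.continuous (funext hu))⟩

/-- The identification of the Bourgain–Brezis–Mironescu space with the dual of the predual. -/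
noncomputable def dualEquiv (𝕜 : Type*) [RCLike 𝕜] {d : ℕ} (hd : 1 ≤ d) :
    BBM 𝕜 d ≃ₗᵢ[𝕜] StrongDual 𝕜 (BBMPredual 𝕜 d) :=
  LinearIsometryEquiv.ofSurjective ⟨(eval 𝕜 d).toLinearMap, norm_eval⟩ (eval_surjective hd)

end BBMPredual

end Predual

/-! ### Atomic series from Hahn–Banach and iterated approximation. -/

section AtomicRepresentation

variable {𝕜 : Type*} [RCLike 𝕜] {d : ℕ}

instance Atom.instNonempty : Nonempty (Atom 𝕜 d) :=
  ⟨⟨0, 1, ∅, one_pos, le_rfl, ⟨by simp, by simp, by simp⟩, aestronglyMeasurable_zero,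
    Filter.Eventually.of_forall fun _ _ => rfl, by simp, by simp⟩⟩

variable {P : Type*} [NormedAddCommGroup P] [NormedSpace 𝕜 P]

/-- `φ` has an atomic representation with coefficients of `ℓ¹` norm at most `s`. -/
def HasAtomicRep (ι : Atom 𝕜 d → P) (φ : P) (s : ℝ) : Prop :=
  ∃ (lam : ℕ → 𝕜) (g : ℕ → Atom 𝕜 d), IsAtomicRep ι φ lam g ∧ ∑' n, ‖lam n‖ ≤ s

namespace HasAtomicRep

variable {ι : Atom 𝕜 d → P} {φ ψ : P} {s t : ℝ}

lemma mono (h : HasAtomicRep ι φ s) (hst : s ≤ t) : HasAtomicRep ι φ t := by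
  obtain ⟨lam, g, h, hs⟩ := h
  exact ⟨lam, g, h, hs.trans hst⟩

lemma smul_atom (ι : Atom 𝕜 d → P) (c : 𝕜) (a : Atom 𝕜 d) : HasAtomicRep ι (c • ι a) ‖c‖ := by
  have h0 : ∀ n, n ≠ 0 → Pi.single (M := fun _ : ℕ => 𝕜) 0 c n = 0 := fun n hn => by simp [hn]
  have hn : HasSum (fun n => ‖Pi.single (M := fun _ : ℕ => 𝕜) 0 c n‖) ‖c‖ := by
    have := hasSum_single (f := fun n => ‖Pi.single (M := fun _ : ℕ => 𝕜) 0 c n‖) 0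
      fun n hn => by rw [h0 n hn, norm_zero]
    simpa using this
  refine ⟨Pi.single 0 c, fun _ => a, ⟨hn.summable, ?_⟩, hn.tsum_eq.le⟩
  have := hasSum_single (f := fun n => Pi.single (M := fun _ : ℕ => 𝕜) 0 c n • ι a) 0
    fun n hn => by rw [h0 n hn, zero_smul]
  simpa using this

lemma zero (ι : Atom 𝕜 d → P) : HasAtomicRep ι 0 0 := by
  simpa using smul_atom ι (0 : 𝕜) (Classical.arbitrary _)

lemma smul (c : 𝕜) (h : HasAtomicRep ι φ s) : HasAtomicRep ι (c • φ) (‖c‖ * s) := by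
  obtain ⟨lam, g, ⟨hs, hφ⟩, hle⟩ := h
  refine ⟨fun n => c * lam n, g, ⟨?_, ?_⟩, ?_⟩
  · simpa only [norm_mul] using hs.mul_left ‖c‖
  · simpa only [mul_smul] using hφ.const_smul c
  · simp only [norm_mul, tsum_mul_left]
    gcongr

lemma norm_le (hι : ∀ a, ‖ι a‖ ≤ 1) (h : HasAtomicRep ι φ s) : ‖φ‖ ≤ s := by
  obtain ⟨lam, g, ⟨hs, hφ⟩, hle⟩ := h
  refine le_trans ?_ hle
  rw [← hφ.tsum_eq]
  refine tsum_of_norm_bounded hs.hasSum fun n => ?_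
  rw [norm_smul]
  exact mul_le_of_le_one_right (norm_nonneg _) (hι _)

/-- Atomic representations of the terms of a series combine to one of its sum. -/
lemma tsum [CompleteSpace P] (hι : ∀ a, ‖ι a‖ ≤ 1) {φ : ℕ → P} {s : ℕ → ℝ}
    (h : ∀ n, HasAtomicRep ι (φ n) (s n)) (hs : Summable s) (hφ : HasSum φ ψ) :
    HasAtomicRep ι ψ (∑' n, s n) := by
  choose lam g hrep hle using h
  have hsum : Summable fun p : ℕ × ℕ => ‖lam p.1 p.2‖ := by
    refine (summable_prod_of_nonneg fun _ => norm_nonneg _).2 ⟨fun n => (hrep n).summable, ?_⟩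
    exact hs.of_nonneg_of_le (fun n => tsum_nonneg fun _ => norm_nonneg _) hle
  have hsumP : Summable fun p : ℕ × ℕ => lam p.1 p.2 • ι (g p.1 p.2) := by
    refine Summable.of_norm_bounded hsum fun p => ?_
    rw [norm_smul]
    exact mul_le_of_le_one_right (norm_nonneg _) (hι _)
  have hψ : HasSum (fun p : ℕ × ℕ => lam p.1 p.2 • ι (g p.1 p.2)) ψ := by
    have h1 := hsumP.hasSum.prod_fiberwise fun n => (hrep n).hasSum
    rw [hφ.unique h1]
    exact hsumP.hasSum
  refine ⟨fun n => lam (Nat.pairEquiv.symm n).1 (Nat.pairEquiv.symm n).2,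
    fun n => g (Nat.pairEquiv.symm n).1 (Nat.pairEquiv.symm n).2, ⟨?_, ?_⟩, ?_⟩
  · exact (Nat.pairEquiv.symm.summable_iff (f := fun p : ℕ × ℕ => ‖lam p.1 p.2‖)).2 hsum
  · exact (Nat.pairEquiv.symm.hasSum_iff
      (f := fun p : ℕ × ℕ => lam p.1 p.2 • ι (g p.1 p.2))).2 hψ
  · rw [Nat.pairEquiv.symm.tsum_eq (fun p : ℕ × ℕ => ‖lam p.1 p.2‖), hsum.tsum_prod]
    exact Summable.tsum_le_tsum hle hsum.prod hs

lemma add [CompleteSpace P] (hι : ∀ a, ‖ι a‖ ≤ 1) (h : HasAtomicRep ι φ s)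
    (h' : HasAtomicRep ι ψ t) : HasAtomicRep ι (φ + ψ) (s + t) := by
  let Φ : ℕ → P := fun n => if n = 0 then φ else if n = 1 then ψ else 0
  let S : ℕ → ℝ := fun n => if n = 0 then s else if n = 1 then t else 0
  have hΦ : HasSum Φ (φ + ψ) := by
    have := hasSum_sum_of_ne_finset_zero (L := .unconditional ℕ) (f := Φ) (s := Finset.range 2)
        fun n hn => by
          simp only [Finset.mem_range, not_lt] at hn
          simp only [Φ]
          rw [if_neg (by omega), if_neg (by omega)]
    simpa [Finset.sum_range_succ, Φ] using this
  have hS : HasSum S (s + t) := by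
    have := hasSum_sum_of_ne_finset_zero (L := .unconditional ℕ) (f := S) (s := Finset.range 2)
        fun n hn => by
          simp only [Finset.mem_range, not_lt] at hn
          simp only [S]
          rw [if_neg (by omega), if_neg (by omega)]
    simpa [Finset.sum_range_succ, S] using this
  rw [← hS.tsum_eq]
  refine tsum hι (fun n => ?_) hS.summable hΦ
  simp only [Φ, S]
  split_ifs
  · exact h
  · exact h'
  · exact zero ι

/-- If atoms norm the dual space up to a factor `2`, then the closure of the elements with atomic
representations of norm at most one contains the ball of radius `1/2`. -/
lemma mem_closure [CompleteSpace P] (hι : ∀ a, ‖ι a‖ ≤ 1)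
    (H : ∀ (Λ : StrongDual 𝕜 P) (u : ℝ), (∀ a, ‖Λ (ι a)‖ ≤ u) → ‖Λ‖ ≤ 2 * u)
    (hφ : ‖φ‖ ≤ 1 / 2) : φ ∈ closure {ψ | HasAtomicRep ι ψ 1} := by
  -- Convexity refers to real scalars, so `P` is also viewed as a real space.
  let _ : NormedSpace ℝ P := NormedSpace.restrictScalars ℝ 𝕜 P
  have _ : IsScalarTower ℝ 𝕜 P := IsScalarTower.restrictScalars ℝ 𝕜 P
  by_contra hcon
  have hconv : Convex ℝ {ψ | HasAtomicRep ι ψ 1} := by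
    intro x hx y hy a b ha hb hab
    have h := add hι (smul (a : 𝕜) hx) (smul (b : 𝕜) hy)
    rw [RCLike.norm_ofReal, RCLike.norm_ofReal, abs_of_nonneg ha, abs_of_nonneg hb, mul_one,
      mul_one, hab] at h
    exact h
  obtain ⟨Λ, u, hu, hux⟩ := RCLike.geometric_hahn_banach_closed_point (𝕜 := 𝕜) hconv.closure
    isClosed_closure hcon
  have hatom : ∀ a, ‖Λ (ι a)‖ ≤ u := by
    intro a
    -- Multiplying the atom by a number of modulus at most one turns the bound on the real part into
    -- a bound on the modulus.
    have h1 := hu (conjSign (Λ (ι a)) • ι a)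
      (subset_closure ((smul_atom ι _ a).mono (norm_conjSign_le _)))
    rw [map_smul, smul_eq_mul, mul_comm, mul_conjSign, RCLike.ofReal_re] at h1
    exact h1.le
  have h2 := H Λ u hatom
  have h3 : RCLike.re (Λ φ) ≤ ‖Λ‖ * ‖φ‖ := (RCLike.re_le_norm _).trans (Λ.le_opNorm φ)
  have h4 : ‖Λ‖ * ‖φ‖ ≤ 2 * u * (1 / 2) :=
    mul_le_mul h2 hφ (norm_nonneg _) ((norm_nonneg _).trans h2)
  linarith

/-- If atoms norm the dual space up to a factor `2`, then every element has an atomic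
representation, with coefficients of `ℓ¹` norm at most four times its norm. -/
theorem of_norming [CompleteSpace P] (hι : ∀ a, ‖ι a‖ ≤ 1)
    (H : ∀ (Λ : StrongDual 𝕜 P) (u : ℝ), (∀ a, ‖Λ (ι a)‖ ≤ u) → ‖Λ‖ ≤ 2 * u) (φ : P) :
    HasAtomicRep ι φ (4 * ‖φ‖) := by
  have step : ∀ x : P, ∃ y, HasAtomicRep ι y (3 * ‖x‖) ∧ ‖x - y‖ ≤ ‖x‖ / 4 := by
    intro x
    rcases eq_or_ne x 0 with rfl | hx
    · exact ⟨0, by simpa using zero ι, by simp⟩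
    have hpos : 0 < ‖x‖ := norm_pos_iff.2 hx
    -- Any factor of at least 2 brings `x` into the ball of radius 1/2. With 3, an error of 1/12
    -- scales back to `‖x‖ / 4`, and the series below sums to `3 / (1 - 1/4) = 4`.
    set c : 𝕜 := ((3 * ‖x‖ : ℝ) : 𝕜) with hc
    have hcn : ‖c‖ = 3 * ‖x‖ := by rw [hc, RCLike.norm_ofReal, abs_of_nonneg (by positivity)]
    have hc0 : c ≠ 0 := norm_pos_iff.1 (by rw [hcn]; positivity)
    have hmem : c⁻¹ • x ∈ closure {ψ | HasAtomicRep ι ψ 1} := by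
      refine mem_closure hι H ?_
      rw [norm_smul, norm_inv, hcn, inv_mul_le_iff₀ (by positivity)]
      linarith
    obtain ⟨y, hy, hxy⟩ := Metric.mem_closure_iff.1 hmem (1 / 12) (by norm_num)
    refine ⟨c • y, ?_, ?_⟩
    · simpa only [hcn, mul_one] using smul c hy
    · have h1 : x - c • y = c • (c⁻¹ • x - y) := by rw [smul_sub, smul_inv_smul₀ hc0]
      rw [h1, norm_smul, hcn, ← dist_eq_norm]
      nlinarith
  choose R hR hR' using step
  -- The successive remainders, each approximated in turn.
  let x : ℕ → P := fun n => Nat.rec φ (fun _ y => y - R y) n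
  have hx0 : x 0 = φ := rfl
  have hx1 : ∀ n, x (n + 1) = x n - R (x n) := fun n => rfl
  have hxn : ∀ n, ‖x n‖ ≤ ‖φ‖ * (1 / 4) ^ n := by
    intro n
    induction n with
    | zero => simp [hx0]
    | succ n ih =>
      rw [hx1, pow_succ]
      refine (hR' _).trans ?_
      linarith
  have hgeom : HasSum (fun n : ℕ => 3 * (‖φ‖ * (1 / 4) ^ n)) (4 * ‖φ‖) := by
    have h := ((hasSum_geometric_of_lt_one (r := (1 / 4 : ℝ)) (by norm_num)
      (by norm_num)).mul_left ‖φ‖).mul_left 3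
    rwa [show 3 * (‖φ‖ * (1 - 1 / 4)⁻¹) = 4 * ‖φ‖ by ring] at h
  have hrep : ∀ n, HasAtomicRep ι (R (x n)) (3 * (‖φ‖ * (1 / 4) ^ n)) := fun n =>
    (hR (x n)).mono (by gcongr; exact hxn n)
  have hpart : ∀ n, ∑ i ∈ Finset.range n, R (x i) = φ - x n := by
    intro n
    induction n with
    | zero => simp [hx0]
    | succ n ih => rw [Finset.sum_range_succ, ih, hx1]; abel
  have hlim : Filter.Tendsto x Filter.atTop (nhds 0) := by
    refine squeeze_zero_norm hxn ?_
    have h := (tendsto_pow_atTop_nhds_zero_of_lt_one (r := (1 / 4 : ℝ)) (by norm_num)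
      (by norm_num)).const_mul ‖φ‖
    rwa [mul_zero] at h
  have hsum : HasSum (fun n => R (x n)) φ := by
    refine (hasSum_iff_tendsto_nat_of_summable_norm
      (hgeom.summable.of_nonneg_of_le (fun _ => norm_nonneg _)
        fun n => (hrep n).norm_le hι)).2 ?_
    simp only [hpart]
    simpa using hlim.const_sub φ
  rw [← hgeom.tsum_eq]
  exact tsum hι hrep hgeom.summable hsum

end HasAtomicRep

/-- The factor 2 is the halving that turns the exact test function into an atom. -/
lemma BBMFun.norm_le_two_mul {f : BBMFun 𝕜 d} {u : ℝ} (h : ∀ g : Atom 𝕜 d, ‖atomPairing f g‖ ≤ u) :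
    ‖f‖ ≤ 2 * u := by
  have hu : 0 ≤ u := (norm_nonneg _).trans (h (Classical.arbitrary _))
  refine ENNReal.toReal_le_of_le_ofReal (by positivity)
    (bbmENorm_le_ofReal (L1.integrable_coeFn _) fun ε F hε hε1 hF => ?_)
  obtain ⟨g, hg, -⟩ := exists_norming_atom (L1.integrable_coeFn f.toL1) hε hε1 hF
  have h1 := congrArg norm hg
  rw [norm_mul, RCLike.norm_ofReal, RCLike.norm_two] at h1
  refine (le_abs_self _).trans (h1.symm.le.trans ?_)
  gcongr
  exact h g

/-- By surjectivity every functional is an evaluation, so the bound on 𝓑 applies. -/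
lemma BBMPredual.norm_le_two_mul (hd : 1 ≤ d) (Λ : StrongDual 𝕜 (BBMPredual 𝕜 d)) (u : ℝ)
    (h : ∀ g, ‖Λ (ofAtom g)‖ ≤ u) : ‖Λ‖ ≤ 2 * u := by
  obtain ⟨b, rfl⟩ := eval_surjective hd Λ
  obtain ⟨f, rfl⟩ := SeparationQuotient.surjective_mk b
  rw [norm_eval, SeparationQuotient.norm_mk]
  exact BBMFun.norm_le_two_mul fun g => by
    rw [← incl_ofAtom_mk]
    exact h g

end AtomicRepresentation

/-- The predual `P` of the Bourgain–Brezis–Mironescu space and its atomic decomposition. The map `J`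
is the isometric identification of `BBM 𝕜 d` with the dual of `P`, and `ι` realizes each atom as
the element of `P` on which `f` acts by `∫ f g`. -/
theorem theorem1p1 :
    ∃ C : ℝ, 0 < C ∧ ∀ (𝕜 : Type) [RCLike 𝕜] (d : ℕ), 2 ≤ d →
      ∃ (P : Type) (_ : NormedAddCommGroup P) (_ : NormedSpace 𝕜 P) (_ : CompleteSpace P)
        (J : BBM 𝕜 d ≃ₗᵢ[𝕜] StrongDual 𝕜 P) (ι : Atom 𝕜 d → P),
        (∀ (f : BBMFun 𝕜 d) (g : Atom 𝕜 d), J (BBM.mk f) (ι g) = atomPairing f g) ∧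
        (∀ φ : P, ∃ (lam : ℕ → 𝕜) (g : ℕ → Atom 𝕜 d), IsAtomicRep ι φ lam g) ∧
        (∀ (φ : P) (lam : ℕ → 𝕜) (g : ℕ → Atom 𝕜 d), IsAtomicRep ι φ lam g →
          ∀ f : BBMFun 𝕜 d, HasSum (fun n => lam n * atomPairing f (g n)) (J (BBM.mk f) φ)) ∧
        (∀ φ : P, C * sInf (atomicSums ι φ) ≤ ‖φ‖ ∧ ‖φ‖ ≤ sInf (atomicSums ι φ)) := by
  -- The inverse of the factor 4 in `HasAtomicRep.of_norming`.
  refine ⟨1 / 4, by norm_num, fun 𝕜 _ d hd => ?_⟩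
  have hd1 : 1 ≤ d := one_le_two.trans hd
  have hrep : ∀ φ : BBMPredual 𝕜 d, HasAtomicRep BBMPredual.ofAtom φ (4 * ‖φ‖) :=
    HasAtomicRep.of_norming BBMPredual.norm_ofAtom_le (BBMPredual.norm_le_two_mul hd1)
  have hJ : ∀ (f : BBMFun 𝕜 d) (g : Atom 𝕜 d),
      BBMPredual.dualEquiv 𝕜 hd1 (BBM.mk f) (BBMPredual.ofAtom g) = atomPairing f g :=
    fun f g => BBMPredual.incl_ofAtom_mk g f
  refine ⟨BBMPredual 𝕜 d, inferInstance, inferInstance, inferInstance,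
    BBMPredual.dualEquiv 𝕜 hd1, BBMPredual.ofAtom, hJ, fun φ => ?_, fun φ lam g h f => ?_,
    fun φ => ⟨?_, ?_⟩⟩
  · obtain ⟨lam, g, h, -⟩ := hrep φ
    exact ⟨lam, g, h⟩
  · have hs := h.hasSum.mapL (BBMPredual.dualEquiv 𝕜 hd1 (BBM.mk f))
    simpa only [map_smul, smul_eq_mul, hJ] using hs
  · obtain ⟨lam, g, h, hle⟩ := hrep φ
    have hinf : sInf (atomicSums BBMPredual.ofAtom φ) ≤ 4 * ‖φ‖ := by
      refine (csInf_le ⟨0, ?_⟩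
        (show ∑' n, ‖lam n‖ ∈ atomicSums _ _ from ⟨lam, g, h, rfl⟩)).trans hle
      rintro _ ⟨lam, g, -, rfl⟩
      exact tsum_nonneg fun _ => norm_nonneg _
    linarith
  · obtain ⟨lam, g, h, -⟩ := hrep φ
    refine le_csInf ⟨_, lam, g, h, rfl⟩ ?_
    rintro _ ⟨lam, g, h, rfl⟩
    have h' : HasAtomicRep BBMPredual.ofAtom φ (∑' n, ‖lam n‖) := ⟨lam, g, h, le_rfl⟩
    exact h'.norm_le BBMPredual.norm_ofAtom_le
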